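/- Let $(X,\varphi)$ be a Cantor minimal system, i.e. $X$ is a Cantor set (a nonempty zero-dimensional compact metrizable space without isolated points) and $\varphi$ is a homeomorphism of $X$ such that for every $x\in X$ the orbit $\mathrm{Orb}_\varphi(x)=\{\varphi^n(x):n\in\mathbb Z\}$ is dense in $X$. Let the full group $[\varphi]$ be the group of all homeomorphisms $f$ of $X$ such that $f(x)\in \mathrm{Orb}_\varphi(x)$ for all $x\in X$, and let the topological full group $[[\varphi]]$ be the subgroup of all $f\in[\varphi]$ for which the function $n_f:X\to\mathbb Z$ determined by $f(x)=\varphi^{n_f(x)}(x)$ for all $x\in X$ is continuous. For a group $G$, let $D(G)$ denote its commutator subgroup, the subgroup generated by all $fgf^{-1}g^{-1}$ with $f,g\in G$. Then: (1) If $H$ is a nontrivial normal subgroup of $[\varphi]$, or a nontrivial normal subgroup of $D([\varphi])$, then $D([\varphi])\subseteq H$. (2) If $H$ is a nontrivial normal subgroup of $[[\varphi]]$, or a nontrivial normal subgroup of $D([[\varphi]])$, then $D([[\varphi]])\subseteq H$. In particular, the groups $D([\varphi])$ and $D([[\varphi]])$ are simple (in particular nontrivial). -/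

import Mathlib

/-- A Cantor set: a nonempty zero-dimensional (clopen sets form a base) compact metrizable space
without isolated points. -/
structure IsCantorSet (X : Type*) [TopologicalSpace X] : Prop where
  nonempty : Nonempty X
  compact : CompactSpace X
  metrizable : TopologicalSpace.MetrizableSpace X
  zeroDim : TopologicalSpace.IsTopologicalBasis {s : Set X | IsClopen s}
  perfect : PerfectSpace X

/-- The orbit `{φⁿ(x) : n ∈ ℤ}` of a point under a homeomorphism. -/
def homeoOrbit {X : Type*} [TopologicalSpace X] (φ : X ≃ₜ X) (x : X) : Set X :=
  {y : X | ∃ n : ℤ, y = (φ ^ n) x}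

/-- A homeomorphism is minimal if the orbit of every point is dense. -/
def IsMinimalHomeo {X : Type*} [TopologicalSpace X] (φ : X ≃ₜ X) : Prop :=
  ∀ x : X, Dense (homeoOrbit φ x)

/-- A Cantor minimal system: a minimal homeomorphism of a Cantor set. -/
structure IsCantorMinimalSystem (X : Type*) [TopologicalSpace X] (φ : X ≃ₜ X) : Prop where
  cantor : IsCantorSet X
  minimal : IsMinimalHomeo φ

/-- The full group `[φ]`: all homeomorphisms `f` with `f(x)` in the `φ`-orbit of `x` for
all `x`. The group operation is composition. -/
def fullGroup {X : Type*} [TopologicalSpace X] (φ : X ≃ₜ X) : Subgroup (X ≃ₜ X) where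
  carrier := {f | ∀ x : X, f x ∈ homeoOrbit φ x}
  one_mem' := fun x => ⟨0, by simp⟩
  mul_mem' := by
    intro f g hf hg x
    obtain ⟨n, hn⟩ := hg x
    obtain ⟨m, hm⟩ := hf (g x)
    exact ⟨m + n, by rw [zpow_add]; change f (g x) = (φ ^ m) ((φ ^ n) x); rw [hm, hn]⟩
  inv_mem' := by
    intro f hf x
    obtain ⟨n, hn⟩ := hf (f⁻¹ x)
    have h1 : f (f⁻¹ x) = x := f.apply_symm_apply x
    rw [h1] at hn
    refine ⟨-n, ?_⟩
    rw [zpow_neg]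
    exact ((φ ^ n).symm_apply_eq.mpr hn).symm

/-- The topological full group `[[φ]]`: all `f` in the full group that have a continuous cocycle,
that is, a continuous `n : X → ℤ` with `f(x) = φ^{n(x)}(x)` for all `x`. (If `φ` is a minimal
homeomorphism of an infinite compact Hausdorff space, all its orbits are infinite and the cocycle
of `f` is unique.) -/
def topologicalFullGroup {X : Type*} [TopologicalSpace X] (φ : X ≃ₜ X) : Subgroup (X ≃ₜ X) where
  carrier := {f | f ∈ fullGroup φ ∧ ∃ n : X → ℤ, Continuous n ∧ ∀ x : X, f x = (φ ^ n x) x}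
  one_mem' := ⟨one_mem _, fun _ => 0, continuous_const, fun x => by simp⟩
  mul_mem' := by
    rintro f g ⟨hf, n, hnc, hn⟩ ⟨hg, m, hmc, hm⟩
    refine ⟨mul_mem hf hg, fun x => n (g x) + m x, (hnc.comp g.continuous).add hmc, fun x => ?_⟩
    rw [zpow_add]
    change f (g x) = (φ ^ n (g x)) ((φ ^ m x) x)
    rw [← hm x, hn (g x)]
  inv_mem' := by
    rintro f ⟨hf, n, hnc, hn⟩
    refine ⟨inv_mem hf, fun x => -n (f⁻¹ x), (hnc.comp (f⁻¹ : X ≃ₜ X).continuous).neg,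
      fun x => ?_⟩
    have h := hn (f⁻¹ x)
    have h1 : f (f⁻¹ x) = x := f.apply_symm_apply x
    rw [h1] at h
    rw [zpow_neg]
    exact ((φ ^ n (f⁻¹ x)).symm_apply_eq.mpr h).symm

/-!
Both groups are handled at once, as a group `Γ` with `φ ∈ Γ ≤ [φ]` that is closed under swaps: if
`γ ∈ Γ` and `A`, `γ(A)` are disjoint clopen sets, then the involution `swapHomeo` exchanging them
belongs to `Γ`. All commutators are formed in the ambient group `X ≃ₜ X`, and it suffices to show
that a nontrivial subgroup `H ≤ Γ` normalized by `⁅Γ, Γ⁆` contains `⁅Γ, Γ⁆`.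

*Commutators in `H`.* Commutators of two swaps are `3`-cycles of clopen sets (`exists_threeCycle`),
so `⁅Γ, Γ⁆` moves every finite set of points, hence every union of four sufficiently small balls,
into a prescribed open set (`exists_commutator_move_balls`). If `h ∈ H` displaces an open set `W`,
then `⁅⁅f', h⁆, g'⁆ = ⁅f', g'⁆` for `f'`, `g'` supported in `W`; applied to `f' = ⁅f, c⁆` and `g' =
⁅g, e⁆` with suitable `3`-cycles `c`, `e` this yields a clopen set `U` such that `⁅f, g⁆ ∈ H` for
all `f, g ∈ Γ` supported in `U` (`exists_commutators_mem`).

*Generation by elements of small support.* For every `ε > 0` the group `Γ` is generated by its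
elements supported in the union of two `ε`-balls (`le_closure_smallElements`). Swaps are products
of such elements, by cutting the clopen set into small pieces. A general `f ∈ Γ` is multiplied by
swaps until it is the identity off a small clopen set `Z` (`exists_mul_eq_id_off`). To make `f` the
identity on a further clopen set `A`, which may contain fixed points of `f`, one first carries `A`
by powers of `φ` into `Z \ f(A)` and from there to `f(A)`. There is enough room in `Z \ f(A)` if
the return time to `A` is long (`exists_map_into_sdiff_image`): if a greedy matching of `A` into `Z
\ f(A)` by powers of `φ` failed at every stage, the empirical measures of orbit segments around
unmatched points would accumulate at `φ`-invariant measures that give `A`, and hence `f(A)`, too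
small a mass compared with `Z`. Here `f` preserves invariant measures because it is pieced together
from countably many powers of `φ`; this is where elements of the full group with a discontinuous
cocycle are controlled.

*Conclusion* (`commutator_le_of_normalized`). Since generators of small support can be moved into
an open set `V` by `⁅Γ, Γ⁆`, every element of `Γ` is the product of an element supported in `V` and
an element of `⁅Γ, Γ⁆`. With `V` disjoint from `U` this shows that the commutators `⁅f, g⁆` above
even lie in the normal core `K` of `H` in `Γ`. Any two generators of small support can be moved
simultaneously into `U`, so they commute modulo `K`. Hence `Γ` is abelian modulo `K`, that is, `⁅Γ,
Γ⁆ ≤ K ≤ H`.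
-/

open Set Topology
open scoped commutatorElement

/-! ### Swaps, supports and 3-cycles -/

section

variable {X : Type*} [TopologicalSpace X]

open Classical in
/-- The involution exchanging a clopen set `A` with its image `γ(A)`, assumed disjoint from `A`:
it is `γ` on `A`, `γ⁻¹` on `γ(A)` and the identity elsewhere. -/
noncomputable def swapHomeo (γ : X ≃ₜ X) (A : Set X) (hA : IsClopen A) (hd : ∀ x ∈ A, γ x ∉ A) :
    X ≃ₜ X where
  toFun x := if x ∈ A then γ x else if γ.symm x ∈ A then γ.symm x else x
  invFun x := if x ∈ A then γ x else if γ.symm x ∈ A then γ.symm x else x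
  left_inv x := by
    by_cases h : x ∈ A
    · simp [h, hd x h]
    · by_cases h' : γ.symm x ∈ A
      · simp [h, h']
      · simp [h, h']
  right_inv x := by
    by_cases h : x ∈ A
    · simp [h, hd x h]
    · by_cases h' : γ.symm x ∈ A
      · simp [h, h']
      · simp [h, h']
  continuous_toFun := by
    have h2 : IsClopen (γ.symm ⁻¹' A) := hA.preimage γ.symm.continuous
    refine Continuous.if (fun a ha => ?_) γ.continuous
      (Continuous.if (fun a ha => ?_) γ.symm.continuous continuous_id)
    · exact absurd (hA.frontier_eq ▸ ha : a ∈ (∅ : Set X)) (notMem_empty a)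
    · exact absurd (h2.frontier_eq ▸ ha : a ∈ (∅ : Set X)) (notMem_empty a)
  continuous_invFun := by
    have h2 : IsClopen (γ.symm ⁻¹' A) := hA.preimage γ.symm.continuous
    refine Continuous.if (fun a ha => ?_) γ.continuous
      (Continuous.if (fun a ha => ?_) γ.symm.continuous continuous_id)
    · exact absurd (hA.frontier_eq ▸ ha : a ∈ (∅ : Set X)) (notMem_empty a)
    · exact absurd (h2.frontier_eq ▸ ha : a ∈ (∅ : Set X)) (notMem_empty a)

section swap

variable {γ : X ≃ₜ X} {A : Set X} {hA : IsClopen A} {hd : ∀ x ∈ A, γ x ∉ A} {x : X}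

theorem swapHomeo_of_mem (h : x ∈ A) : swapHomeo γ A hA hd x = γ x :=
  if_pos h

theorem swapHomeo_image (h : x ∈ A) : swapHomeo γ A hA hd (γ x) = x := by
  simp [swapHomeo, h, hd x h]

theorem swapHomeo_of_symm_mem (h : γ.symm x ∈ A) : swapHomeo γ A hA hd x = γ.symm x := by
  conv_lhs => rw [← γ.apply_symm_apply x]
  exact swapHomeo_image h

theorem swapHomeo_of_notMem (h : x ∉ A) (h' : γ.symm x ∉ A) : swapHomeo γ A hA hd x = x := by
  simp [swapHomeo, h, h']

theorem swapHomeo_inv : (swapHomeo γ A hA hd)⁻¹ = swapHomeo γ A hA hd := rfl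

end swap

/-- A group of homeomorphisms is closed under swaps if it contains the swap of `A` and `γ(A)`
whenever it contains `γ` and the clopen sets `A`, `γ(A)` are disjoint. -/
def SwapClosed (Γ : Subgroup (X ≃ₜ X)) : Prop :=
  ∀ γ ∈ Γ, ∀ (A : Set X) (hA : IsClopen A) (hd : ∀ x ∈ A, γ x ∉ A), swapHomeo γ A hA hd ∈ Γ

/-- The elements of `Γ` supported in `U`. -/
def supportedIn (Γ : Subgroup (X ≃ₜ X)) (U : Set X) : Subgroup (X ≃ₜ X) where
  carrier := {f | f ∈ Γ ∧ ∀ x, x ∉ U → f x = x}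
  one_mem' := ⟨one_mem _, fun _ _ => rfl⟩
  mul_mem' := by
    rintro f g ⟨hf, hf'⟩ ⟨hg, hg'⟩
    exact ⟨mul_mem hf hg, fun x hx => by rw [Homeomorph.mul_apply, hg' x hx, hf' x hx]⟩
  inv_mem' := by
    rintro f ⟨hf, hf'⟩
    exact ⟨inv_mem hf, fun x hx => by
      rw [Homeomorph.inv_apply, Homeomorph.symm_apply_eq, hf' x hx]⟩

theorem supportedIn_mono (Γ : Subgroup (X ≃ₜ X)) {U V : Set X} (h : U ⊆ V) :
    supportedIn Γ U ≤ supportedIn Γ V :=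
  fun _ hf => ⟨hf.1, fun x hx => hf.2 x fun hU => hx (h hU)⟩

/-- Conjugation moves supports: if `δ` carries the support of `f` into `V`, then `δ f δ⁻¹` is
supported in `V`. -/
theorem conj_mem_supportedIn {Γ : Subgroup (X ≃ₜ X)} {U V : Set X} {f δ : X ≃ₜ X}
    (hf : f ∈ supportedIn Γ U) (hδ : δ ∈ Γ) (h : ∀ x ∈ U, δ x ∈ V) :
    δ * f * δ⁻¹ ∈ supportedIn Γ V := by
  refine ⟨mul_mem (mul_mem hδ hf.1) (inv_mem hδ), fun x hx => ?_⟩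
  have h1 : δ⁻¹ x ∉ U := fun hU => hx (by simpa using h _ hU)
  rw [Homeomorph.mul_apply, Homeomorph.mul_apply, hf.2 _ h1]
  simp

/-- Elements with disjoint supports commute. -/
theorem commute_of_supportedIn {Γ : Subgroup (X ≃ₜ X)} {U V : Set X} {f g : X ≃ₜ X}
    (hf : f ∈ supportedIn Γ U) (hg : g ∈ supportedIn Γ V) (h : Disjoint U V) :
    Commute f g := by
  refine Homeomorph.ext fun x => ?_
  simp only [Homeomorph.mul_apply]
  by_cases hx : x ∈ U
  · have h1 : x ∉ V := fun hV => Set.disjoint_left.1 h hx hV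
    rw [hg.2 x h1]
    by_cases h2 : f x ∈ V
    · have h3 : f (f x) = f x := hf.2 _ fun hU => Set.disjoint_left.1 h hU h2
      rw [f.injective h3, hg.2 x h1]
    · rw [hg.2 _ h2]
  · rw [hf.2 x hx]
    by_cases h2 : g x ∈ U
    · have h3 : g (g x) = g x := hg.2 _ fun hV => Set.disjoint_left.1 h h2 hV
      rw [g.injective h3, hf.2 x hx]
    · rw [hf.2 _ h2]

/-- If `A`, `a(A)`, `b(A)` are pairwise disjoint, the commutator of the two swaps along `a` and `b`
is a `3`-cycle `A → a(A) → b(A) → A`. This is the source of all elements of the commutator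
subgroup that are used to move sets around. -/
theorem exists_threeCycle {Γ : Subgroup (X ≃ₜ X)} (hΓ : SwapClosed Γ) {a b : X ≃ₜ X}
    (ha : a ∈ Γ) (hb : b ∈ Γ) {A : Set X} (hA : IsClopen A)
    (h1 : ∀ x ∈ A, a x ∉ A) (h2 : ∀ x ∈ A, b x ∉ A) (h3 : ∀ x ∈ A, ∀ y ∈ A, a x ≠ b y) :
    ∃ c ∈ ⁅Γ, Γ⁆, (∀ x ∈ A, c x = a x) ∧
      ∀ x, x ∉ A → a.symm x ∉ A → b.symm x ∉ A → c x = x := by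
  refine ⟨⁅swapHomeo a A hA h1, swapHomeo b A hA h2⁆,
    Subgroup.commutator_mem_commutator (hΓ a ha A hA h1) (hΓ b hb A hA h2), ?_, ?_⟩
  · intro x hx
    have h4 : a.symm (b x) ∉ A := fun h => h3 _ h x hx (by simp)
    simp only [commutatorElement_def, Homeomorph.mul_apply, swapHomeo_inv]
    rw [swapHomeo_of_mem (γ := b) hx, swapHomeo_of_notMem (h2 x hx) h4, swapHomeo_image hx,
      swapHomeo_of_mem hx]
  · intro x hx hax hbx
    simp only [commutatorElement_def, Homeomorph.mul_apply, swapHomeo_inv]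
    rw [swapHomeo_of_notMem (γ := b) hx hbx, swapHomeo_of_notMem hx hax,
      swapHomeo_of_notMem hx hbx, swapHomeo_of_notMem hx hax]

/-- Three points `x`, `a x`, `b x` that are pairwise distinct have a clopen neighbourhood `A` of
`x` whose images `A`, `a(A)`, `b(A)` are pairwise disjoint. -/
theorem exists_clopen_three [T2Space X]
    (hB : TopologicalSpace.IsTopologicalBasis {s : Set X | IsClopen s}) {a b : X ≃ₜ X} {x : X}
    (h1 : a x ≠ x) (h2 : b x ≠ x) (h3 : a x ≠ b x) {O : Set X} (hO : IsOpen O) (hx : x ∈ O) :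
    ∃ A : Set X, IsClopen A ∧ x ∈ A ∧ A ⊆ O ∧ (∀ y ∈ A, a y ∉ A) ∧ (∀ y ∈ A, b y ∉ A) ∧
      ∀ y ∈ A, ∀ z ∈ A, a y ≠ b z := by
  obtain ⟨U1, V1, hU1, hV1, hxU1, hxV1, hd1⟩ := t2_separation h1
  obtain ⟨U2, V2, hU2, hV2, hxU2, hxV2, hd2⟩ := t2_separation h2
  obtain ⟨U3, V3, hU3, hV3, hxU3, hxV3, hd3⟩ := t2_separation h3
  obtain ⟨A, hA, hxA, hAO⟩ := hB.exists_subset_of_mem_open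
    (u := O ∩ (V1 ∩ V2) ∩ (a ⁻¹' (U1 ∩ U3)) ∩ (b ⁻¹' (U2 ∩ V3)))
    ⟨⟨⟨hx, hxV1, hxV2⟩, hxU1, hxU3⟩, hxU2, hxV3⟩
    (((hO.inter (hV1.inter hV2)).inter ((hU1.inter hU3).preimage a.continuous)).inter
      ((hU2.inter hV3).preimage b.continuous))
  refine ⟨A, hA, hxA, fun y hy => (hAO hy).1.1.1, fun y hy hay => ?_, fun y hy hby => ?_,
    fun y hy z hz h => ?_⟩
  · exact Set.disjoint_left.1 hd1 (hAO hy).1.2.1 (hAO hay).1.1.2.1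
  · exact Set.disjoint_left.1 hd2 (hAO hy).2.1 (hAO hby).1.1.2.2
  · exact Set.disjoint_left.1 hd3 (hAO hy).1.2.2 (h ▸ (hAO hz).2.2)

end

/-! ### Moving points by commutators, and commutators in normalized subgroups -/

section

variable {X : Type*} [TopologicalSpace X]

/-- The orbit of every point under `Γ` meets every nonempty open set. -/
def IsMinimalGroup (Γ : Subgroup (X ≃ₜ X)) : Prop :=
  ∀ (x : X) (V : Set X), IsOpen V → V.Nonempty → ∃ γ ∈ Γ, γ x ∈ V

/-- A point can be moved into `V` by an element of the commutator subgroup that fixes a given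
finite set not containing the point. -/
theorem exists_commutator_move_point [T2Space X] [PerfectSpace X]
    (hB : TopologicalSpace.IsTopologicalBasis {s : Set X | IsClopen s})
    {Γ : Subgroup (X ≃ₜ X)} (hΓ : SwapClosed Γ) (hmin : IsMinimalGroup Γ)
    {V : Set X} (hV : IsOpen V) (hne : V.Nonempty) {x : X} {F : Set X} (hF : F.Finite)
    (hx : x ∉ F) : ∃ d ∈ ⁅Γ, Γ⁆, d x ∈ V ∧ d x ≠ x ∧ ∀ y ∈ F, d y = y := by
  have key : ∀ E : Set X, E.Finite → ∃ a ∈ Γ, a x ∈ V ∧ a x ∉ E := by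
    intro E hE
    obtain ⟨v, hv⟩ := hne
    have hinf : V.Infinite := infinite_of_mem_nhds v (hV.mem_nhds hv)
    obtain ⟨a, ha, hav, hae⟩ := hmin x (V \ E) (hV.sdiff hE.isClosed)
      (hinf.sdiff hE).nonempty
    exact ⟨a, ha, hav, hae⟩
  obtain ⟨a, ha, haV, haE⟩ := key (insert x F) (hF.insert x)
  obtain ⟨b, hb, hbV, hbE⟩ := key (insert (a x) (insert x F)) ((hF.insert x).insert _)
  simp only [mem_insert_iff, not_or] at haE hbE
  have hO : IsOpen (Fᶜ ∩ a ⁻¹' Fᶜ ∩ b ⁻¹' Fᶜ) :=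
    (hF.isClosed.isOpen_compl.inter (hF.isClosed.isOpen_compl.preimage a.continuous)).inter
      (hF.isClosed.isOpen_compl.preimage b.continuous)
  obtain ⟨A, hA, hxA, hAO, h1, h2, h3⟩ := exists_clopen_three hB haE.1 hbE.2.1
    (Ne.symm hbE.1) hO ⟨⟨hx, haE.2⟩, hbE.2.2⟩
  obtain ⟨c, hc, hcA, hcf⟩ := exists_threeCycle hΓ ha hb hA h1 h2 h3
  refine ⟨c, hc, by rwa [hcA x hxA], by rw [hcA x hxA]; exact haE.1, fun y hy => hcf y ?_ ?_ ?_⟩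
  · exact fun h => (hAO h).1.1 hy
  · exact fun h => (hAO h).1.2 (by simpa using hy)
  · exact fun h => (hAO h).2 (by simpa using hy)

/-- The commutator subgroup moves every finite set into every nonempty open set. -/
theorem exists_commutator_move_finset [T2Space X] [PerfectSpace X]
    (hB : TopologicalSpace.IsTopologicalBasis {s : Set X | IsClopen s})
    {Γ : Subgroup (X ≃ₜ X)} (hΓ : SwapClosed Γ) (hmin : IsMinimalGroup Γ)
    {V : Set X} (hV : IsOpen V) (hne : V.Nonempty) {F : Set X} (hF : F.Finite) :
    ∃ d ∈ ⁅Γ, Γ⁆, ∀ y ∈ F, d y ∈ V := by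
  induction F, hF using Set.Finite.induction_on with
  | empty => exact ⟨1, one_mem _, by simp⟩
  | @insert x F hx hF ih =>
    obtain ⟨d, hd, hdF⟩ := ih
    have h1 : d x ∉ d '' F := by
      rintro ⟨y, hy, h⟩
      exact hx (d.injective h ▸ hy)
    obtain ⟨e, he, heV, -, hef⟩ :=
      exists_commutator_move_point hB hΓ hmin hV hne (hF.image d) h1
    refine ⟨e * d, mul_mem he hd, ?_⟩
    rintro y (rfl | hy)
    · exact heV
    · rw [Homeomorph.mul_apply, hef _ (mem_image_of_mem d hy)]
      exact hdF y hy

/-- A Higman-type argument: a nontrivial subgroup normalized by the commutator subgroup contains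
all commutators of elements supported in some nonempty clopen set. -/
theorem exists_commutators_mem [T2Space X] [PerfectSpace X]
    (hB : TopologicalSpace.IsTopologicalBasis {s : Set X | IsClopen s})
    {Γ : Subgroup (X ≃ₜ X)} (hΓ : SwapClosed Γ) (hmin : IsMinimalGroup Γ)
    {H : Subgroup (X ≃ₜ X)} (hH : H ≤ Γ) (hD : ∀ d ∈ ⁅Γ, Γ⁆, ∀ h ∈ H, d * h * d⁻¹ ∈ H)
    (hne : H ≠ ⊥) :
    ∃ U : Set X, IsClopen U ∧ U.Nonempty ∧
      ∀ f ∈ supportedIn Γ U, ∀ g ∈ supportedIn Γ U, ⁅f, g⁆ ∈ H := by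
  obtain ⟨h, hh, h1⟩ : ∃ h ∈ H, h ≠ 1 := by
    by_contra! hc
    exact hne ((Subgroup.eq_bot_iff_forall H).2 hc)
  obtain ⟨x, hx⟩ : ∃ x, h x ≠ x := by
    by_contra! hc
    exact h1 (Homeomorph.ext hc)
  obtain ⟨P, Q, hP, hQ, hxP, hxQ, hPQ⟩ := t2_separation hx
  -- `W` is displaced by `h`
  let W := Q ∩ h ⁻¹' P
  have hW : IsOpen W := hQ.inter (hP.preimage h.continuous)
  have hxW : x ∈ W := ⟨hxQ, hxP⟩
  have hhW : ∀ y ∈ W, h y ∉ W := fun y hy hy' => Set.disjoint_left.1 hPQ hy.2 hy'.1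
  have key : ∀ E : Set X, E.Finite → ∃ a ∈ Γ, a x ∈ W ∧ a x ∉ E := by
    intro E hE
    have hinf : W.Infinite := infinite_of_mem_nhds x (hW.mem_nhds hxW)
    obtain ⟨a, ha, hav, hae⟩ := hmin x (W \ E) (hW.sdiff hE.isClosed)
      (hinf.sdiff hE).nonempty
    exact ⟨a, ha, hav, hae⟩
  obtain ⟨a, ha, haW, hax⟩ := key {x} (finite_singleton x)
  obtain ⟨b, hb, hbW, hbx⟩ := key {a x, x} (by simp)
  simp only [mem_insert_iff, mem_singleton_iff, not_or] at hax hbx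
  obtain ⟨A, hA, hxA, hAO, h1, h2, h3⟩ := exists_clopen_three hB hax hbx.2
    (Ne.symm hbx.1) ((hW.inter (hW.preimage a.continuous)).inter (hW.preimage b.continuous))
      ⟨⟨hxW, haW⟩, hbW⟩
  obtain ⟨c, hc, hcA, -⟩ := exists_threeCycle hΓ ha hb hA h1 h2 h3
  obtain ⟨e, he, heA, -⟩ := exists_threeCycle hΓ hb ha hA h2 h1
    (fun y hy z hz => (h3 z hz y hy).symm)
  have hDΓ : ⁅Γ, Γ⁆ ≤ Γ := Subgroup.commutator_le_self Γ
  refine ⟨A, hA, ⟨x, hxA⟩, fun f hf g hg => ?_⟩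
  -- `f₁`, `g₁` are the inverses of `f`, `g` transported to the disjoint sets `a(A)`, `b(A)`
  let f₁ := c * f⁻¹ * c⁻¹
  let g₁ := e * g⁻¹ * e⁻¹
  have hf₁ : f₁ ∈ supportedIn Γ (a '' A) := conj_mem_supportedIn (inv_mem hf) (hDΓ hc)
    fun y hy => ⟨y, hy, (hcA y hy).symm⟩
  have hg₁ : g₁ ∈ supportedIn Γ (b '' A) := conj_mem_supportedIn (inv_mem hg) (hDΓ he)
    fun y hy => ⟨y, hy, (heA y hy).symm⟩
  have haA : a '' A ⊆ W := by rintro _ ⟨y, hy, rfl⟩; exact (hAO hy).1.2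
  have hbA : b '' A ⊆ W := by rintro _ ⟨y, hy, rfl⟩; exact (hAO hy).2
  have hAW : A ⊆ W := fun y hy => (hAO hy).1.1
  have hf' : f * f₁ ∈ supportedIn Γ W :=
    mul_mem (supportedIn_mono Γ hAW hf) (supportedIn_mono Γ haA hf₁)
  have hg' : g * g₁ ∈ supportedIn Γ W :=
    mul_mem (supportedIn_mono Γ hAW hg) (supportedIn_mono Γ hbA hg₁)
  have hfD : f * f₁ ∈ ⁅Γ, Γ⁆ := by
    have : f * f₁ = ⁅f, c⁆ := by simp only [f₁, commutatorElement_def, mul_assoc]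
    rw [this]
    exact Subgroup.commutator_mem_commutator hf.1 (hDΓ hc)
  have hgD : g * g₁ ∈ ⁅Γ, Γ⁆ := by
    have : g * g₁ = ⁅g, e⁆ := by simp only [g₁, commutatorElement_def, mul_assoc]
    rw [this]
    exact Subgroup.commutator_mem_commutator hg.1 (hDΓ he)
  have dis1 : Disjoint A (b '' A) := Set.disjoint_left.2 fun y hy ⟨z, hz, hzy⟩ =>
    h2 z hz (hzy ▸ hy)
  have dis2 : Disjoint (a '' A) A := Set.disjoint_left.2 fun y ⟨z, hz, hzy⟩ hy =>
    h1 z hz (hzy ▸ hy)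
  have dis3 : Disjoint (a '' A) (b '' A) := Set.disjoint_left.2 fun y ⟨z, hz, hzy⟩ ⟨w, hw, hwy⟩ =>
    h3 z hz w hw (hzy.trans hwy.symm)
  -- the transported parts do not contribute to the commutator
  have hfg : ⁅f * f₁, g * g₁⁆ = ⁅f, g⁆ := by
    have c1 : Commute f₁ (g * g₁) :=
      (commute_of_supportedIn hf₁ hg dis2).mul_right (commute_of_supportedIn hf₁ hg₁ dis3)
    have c2 : Commute f g₁ := commute_of_supportedIn hf hg₁ dis1
    have e1 : f * f₁ * (g * g₁) = f * (g * g₁) * f₁ := by rw [mul_assoc, c1.eq, mul_assoc f]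
    have e2 : f * (g * g₁) = f * g * f⁻¹ * g₁ * f := by
      have := c2.inv_left.eq
      rw [mul_assoc (f * g) f⁻¹, this]
      group
    rw [commutatorElement_def, e1, e2, commutatorElement_def]
    group
  -- conjugation by `h` moves `f * f₁` off the support of `g * g₁`
  have hcomm : Commute (h * (f * f₁)⁻¹ * h⁻¹) (g * g₁) := by
    have h4 : h * (f * f₁)⁻¹ * h⁻¹ ∈ supportedIn Γ Wᶜ :=
      conj_mem_supportedIn (inv_mem hf') (hH hh) hhW
    exact commute_of_supportedIn h4 hg' disjoint_compl_left
  have hk : ⁅f * f₁, h⁆ ∈ H := by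
    rw [commutatorElement_def]
    exact mul_mem (hD _ hfD _ hh) (inv_mem hh)
  have hkg : ⁅⁅f * f₁, h⁆, g * g₁⁆ ∈ H := by
    have := mul_mem hk (hD _ hgD _ (inv_mem hk))
    rw [commutatorElement_def]
    simpa only [mul_assoc] using this
  rw [← hfg]
  convert hkg using 1
  have e3 : ⁅f * f₁, h⁆ = f * f₁ * (h * (f * f₁)⁻¹ * h⁻¹) := by
    simp only [commutatorElement_def, mul_assoc]
  generalize h * (f * f₁)⁻¹ * h⁻¹ = u at hcomm e3
  rw [e3, commutatorElement_def, commutatorElement_def, mul_inv_rev,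
    mul_assoc (f * f₁) u (g * g₁), hcomm.eq]
  group

end

/-! ### Reduction to generation by elements of small support -/

/-- The elements of `Γ` supported in the union of two balls of radius `ε`. -/
def smallElements {X : Type*} [MetricSpace X] (Γ : Subgroup (X ≃ₜ X)) (ε : ℝ) : Set (X ≃ₜ X) :=
  {s | ∃ x y : X, s ∈ supportedIn Γ (Metric.ball x ε ∪ Metric.ball y ε)}

section

variable {X : Type*} [MetricSpace X]

/-- A uniform version of `exists_commutator_move_finset`: by a Lebesgue number argument, the union
of any four sufficiently small balls can be moved into `V`. -/
theorem exists_commutator_move_balls [CompactSpace X] [PerfectSpace X]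
    (hB : TopologicalSpace.IsTopologicalBasis {s : Set X | IsClopen s})
    {Γ : Subgroup (X ≃ₜ X)} (hΓ : SwapClosed Γ) (hmin : IsMinimalGroup Γ)
    {V : Set X} (hV : IsOpen V) (hne : V.Nonempty) :
    ∃ ε > 0, ∀ p : Fin 4 → X, ∃ d ∈ ⁅Γ, Γ⁆, ∀ i, ∀ z ∈ Metric.ball (p i) ε, d z ∈ V := by
  obtain ⟨ε, hε, h⟩ := lebesgue_number_lemma_of_metric (α := Fin 4 → X)
    (ι := (⁅Γ, Γ⁆ : Subgroup (X ≃ₜ X))) (s := univ)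
    (c := fun d => {q | ∀ i, (d : X ≃ₜ X) (q i) ∈ V}) isCompact_univ
    (fun d => by
      simp only [ofPred_forall]
      exact isOpen_iInter_of_finite fun i =>
        hV.preimage ((d : X ≃ₜ X).continuous.comp (continuous_apply i)))
    (fun q _ => by
      obtain ⟨d, hd, h⟩ := exists_commutator_move_finset hB hΓ hmin hV hne (finite_range q)
      exact mem_iUnion.2 ⟨⟨d, hd⟩, fun i => h _ (mem_range_self i)⟩)
  refine ⟨ε, hε, fun p => ?_⟩
  obtain ⟨⟨d, hd⟩, hball⟩ := h p (mem_univ p)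
  refine ⟨d, hd, fun i z hz => ?_⟩
  have h1 : Function.update p i z ∈ Metric.ball p ε := by
    rw [Metric.mem_ball, dist_pi_lt_iff hε]
    intro j
    by_cases hj : j = i
    · subst hj; simpa using hz
    · simpa [hj] using hε
  simpa using hball h1 i

/-- If `Γ` is generated by elements of small support, then every element of `Γ` is the product of
an element supported in `V` and an element of the commutator subgroup. -/
theorem le_supportedIn_sup_commutator [CompactSpace X] [PerfectSpace X]
    (hB : TopologicalSpace.IsTopologicalBasis {s : Set X | IsClopen s})
    {Γ : Subgroup (X ≃ₜ X)} (hΓ : SwapClosed Γ) (hmin : IsMinimalGroup Γ)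
    (hgen : ∀ ε > 0, Γ ≤ Subgroup.closure (smallElements Γ ε))
    {V : Set X} (hV : IsOpen V) (hne : V.Nonempty) :
    ∀ γ ∈ Γ, ∃ σ ∈ supportedIn Γ V, ∃ d ∈ ⁅Γ, Γ⁆, γ = σ * d := by
  have hDΓ : ⁅Γ, Γ⁆ ≤ Γ := Subgroup.commutator_le_self Γ
  have hconj : ∀ γ ∈ Γ, ∀ d ∈ ⁅Γ, Γ⁆, γ * d * γ⁻¹ ∈ ⁅Γ, Γ⁆ := by
    intro γ hγ d hd
    have h1 : ⁅γ, d⁆ ∈ ⁅Γ, Γ⁆ := Subgroup.commutator_mem_commutator hγ (hDΓ hd)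
    have h2 : γ * d * γ⁻¹ = ⁅γ, d⁆ * d := by rw [commutatorElement_def]; group
    rw [h2]
    exact mul_mem h1 hd
  obtain ⟨ε, hε, hmove⟩ := exists_commutator_move_balls hB hΓ hmin hV hne
  intro γ hγ
  induction hgen ε hε hγ using Subgroup.closure_induction with
  | mem s hs =>
    obtain ⟨x, y, hs⟩ := hs
    obtain ⟨ρ, hρ, hρV⟩ := hmove ![x, y, x, y]
    refine ⟨ρ * s * ρ⁻¹, conj_mem_supportedIn hs (hDΓ hρ) ?_, ⁅ρ, s⁻¹⁆, ?_, ?_⟩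
    · rintro z (hz | hz)
      · exact hρV 0 z hz
      · exact hρV 1 z hz
    · exact Subgroup.commutator_mem_commutator (hDΓ hρ) (inv_mem hs.1)
    · rw [commutatorElement_def]
      group
  | one => exact ⟨1, one_mem _, 1, one_mem _, by simp⟩
  | mul a b ha hb iha ihb =>
    have hcl : Subgroup.closure (smallElements Γ ε) ≤ Γ :=
      (Subgroup.closure_le Γ).2 fun s ⟨_, _, hs⟩ => hs.1
    obtain ⟨σ, hσ, d, hd, rfl⟩ := iha (hcl ha)
    obtain ⟨τ, hτ, e, he, rfl⟩ := ihb (hcl hb)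
    refine ⟨σ * τ, mul_mem hσ hτ, τ⁻¹ * d * τ * e, mul_mem ?_ he, by group⟩
    simpa using hconj τ⁻¹ (inv_mem hτ.1) d hd
  | inv a ha iha =>
    have hcl : Subgroup.closure (smallElements Γ ε) ≤ Γ :=
      (Subgroup.closure_le Γ).2 fun s ⟨_, _, hs⟩ => hs.1
    obtain ⟨σ, hσ, d, hd, rfl⟩ := iha (hcl ha)
    exact ⟨σ⁻¹, inv_mem hσ, σ * d⁻¹ * σ⁻¹, hconj σ hσ.1 _ (inv_mem hd), by group⟩

/-- The main reduction: if `Γ` is generated by elements supported in two small balls, then every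
nontrivial subgroup normalized by the commutator subgroup contains the commutator subgroup. -/
theorem commutator_le_of_normalized [CompactSpace X] [PerfectSpace X]
    (hB : TopologicalSpace.IsTopologicalBasis {s : Set X | IsClopen s})
    {Γ : Subgroup (X ≃ₜ X)} (hΓ : SwapClosed Γ) (hmin : IsMinimalGroup Γ)
    (hgen : ∀ ε > 0, Γ ≤ Subgroup.closure (smallElements Γ ε))
    {H : Subgroup (X ≃ₜ X)} (hH : H ≤ Γ) (hD : ∀ d ∈ ⁅Γ, Γ⁆, ∀ h ∈ H, d * h * d⁻¹ ∈ H)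
    (hne : H ≠ ⊥) : ⁅Γ, Γ⁆ ≤ H := by
  have hDΓ : ⁅Γ, Γ⁆ ≤ Γ := Subgroup.commutator_le_self Γ
  obtain ⟨U₀, hU₀, ⟨u, hu⟩, hU₀H⟩ := exists_commutators_mem hB hΓ hmin hH hD hne
  -- shrink `U₀` so that its complement is nonempty
  obtain ⟨U, hU, huU, hUU₀, V, hV, hVne, hUV⟩ : ∃ U : Set X, IsOpen U ∧ u ∈ U ∧ U ⊆ U₀ ∧
      ∃ V : Set X, IsOpen V ∧ V.Nonempty ∧ Disjoint U V := by
    obtain ⟨v, hv⟩ := (infinite_of_mem_nhds u Filter.univ_mem).exists_notMem_finset {u}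
    obtain ⟨P, Q, hP, hQ, hvP, huQ, hPQ⟩ := t2_separation (x := v) (y := u) (by simpa using hv.2)
    exact ⟨U₀ ∩ Q, hU₀.isOpen.inter hQ, ⟨hu, huQ⟩, inter_subset_left, P, hP, ⟨v, hvP⟩,
      hPQ.symm.mono_left inter_subset_right⟩
  -- `K` is the normal core of `H` in `Γ`
  let K : Subgroup (X ≃ₜ X) :=
    { carrier := {h | ∀ γ ∈ Γ, γ * h * γ⁻¹ ∈ H}
      one_mem' := fun γ _ => by simp [one_mem]
      mul_mem' := fun {a b} ha hb γ hγ => by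
        have := mul_mem (ha γ hγ) (hb γ hγ)
        have e : γ * (a * b) * γ⁻¹ = γ * a * γ⁻¹ * (γ * b * γ⁻¹) := by group
        rwa [e]
      inv_mem' := fun {a} ha γ hγ => by
        have := inv_mem (ha γ hγ)
        have e : γ * a⁻¹ * γ⁻¹ = (γ * a * γ⁻¹)⁻¹ := by group
        rwa [e] }
  have hKconj : ∀ γ ∈ Γ, ∀ k ∈ K, γ * k * γ⁻¹ ∈ K := by
    intro γ hγ k hk δ hδ
    have := hk (δ * γ) (mul_mem hδ hγ)
    have e : δ * (γ * k * γ⁻¹) * δ⁻¹ = δ * γ * k * (δ * γ)⁻¹ := by group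
    rwa [e]
  have hUK : ∀ f ∈ supportedIn Γ U, ∀ g ∈ supportedIn Γ U, ⁅f, g⁆ ∈ K := by
    intro f hf g hg γ hγ
    obtain ⟨σ, hσ, d, hd, hγe⟩ := le_supportedIn_sup_commutator hB hΓ hmin hgen hV hVne γ⁻¹
      (inv_mem hγ)
    -- `γ = d⁻¹ σ⁻¹`, and `σ⁻¹` commutes with everything supported in `U`
    have hc1 : Commute f σ⁻¹ := commute_of_supportedIn hf (inv_mem hσ) hUV
    have hc2 : Commute g σ⁻¹ := commute_of_supportedIn hg (inv_mem hσ) hUV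
    have hc : Commute ⁅f, g⁆ σ⁻¹ := by
      rw [commutatorElement_def]
      exact ((hc1.mul_left hc2).mul_left hc1.inv_left).mul_left hc2.inv_left
    have hfg : ⁅f, g⁆ ∈ H :=
      hU₀H f (supportedIn_mono Γ hUU₀ hf) g (supportedIn_mono Γ hUU₀ hg)
    have := hD d⁻¹ (inv_mem hd) _ hfg
    have e : γ * ⁅f, g⁆ * γ⁻¹ = d⁻¹ * ⁅f, g⁆ * d⁻¹⁻¹ := by
      have e1 : γ = d⁻¹ * σ⁻¹ := by rw [← inv_inv γ, hγe, mul_inv_rev]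
      rw [e1, mul_assoc d⁻¹ σ⁻¹, ← hc.eq]
      group
    rwa [e]
  obtain ⟨ε, hε, hmove⟩ := exists_commutator_move_balls hB hΓ hmin hU ⟨u, huU⟩
  have hsmall : ∀ s ∈ smallElements Γ ε, ∀ t ∈ smallElements Γ ε, ⁅s, t⁆ ∈ K := by
    rintro s ⟨x, y, hs⟩ t ⟨x', y', ht⟩
    obtain ⟨d, hd, hdU⟩ := hmove ![x, y, x', y']
    have hs' : d * s * d⁻¹ ∈ supportedIn Γ U := conj_mem_supportedIn hs (hDΓ hd) (by
      rintro z (hz | hz)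
      exacts [hdU 0 z hz, hdU 1 z hz])
    have ht' : d * t * d⁻¹ ∈ supportedIn Γ U := conj_mem_supportedIn ht (hDΓ hd) (by
      rintro z (hz | hz)
      exacts [hdU 2 z hz, hdU 3 z hz])
    have := hKconj d⁻¹ (inv_mem (hDΓ hd)) _ (hUK _ hs' _ ht')
    have e : ⁅s, t⁆ = d⁻¹ * ⁅d * s * d⁻¹, d * t * d⁻¹⁆ * d⁻¹⁻¹ := by
      simp only [commutatorElement_def]; group
    rwa [e]
  -- generators commute modulo the normal subgroup `K`, hence so do all elements
  have hcl : Subgroup.closure (smallElements Γ ε) ≤ Γ :=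
    (Subgroup.closure_le Γ).2 fun s ⟨_, _, hs⟩ => hs.1
  have hext : ∀ T : Set (X ≃ₜ X), ∀ t : X ≃ₜ X, T ⊆ Γ → t ∈ Γ → (∀ s ∈ T, ⁅s, t⁆ ∈ K) →
      ∀ s ∈ Subgroup.closure T, ⁅s, t⁆ ∈ K := by
    intro T t hT ht h s hs
    have hTΓ : Subgroup.closure T ≤ Γ := (Subgroup.closure_le Γ).2 hT
    induction hs using Subgroup.closure_induction with
    | mem s hs => exact h s hs
    | one => simp
    | mul a b ha hb iha ihb =>
      have e : ⁅a * b, t⁆ = a * ⁅b, t⁆ * a⁻¹ * ⁅a, t⁆ := by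
        simp only [commutatorElement_def]; group
      rw [e]
      exact mul_mem (hKconj a (hTΓ ha) _ ihb) iha
    | inv a ha iha =>
      have e : ⁅a⁻¹, t⁆ = a⁻¹ * ⁅a, t⁆⁻¹ * a⁻¹⁻¹ := by
        simp only [commutatorElement_def]; group
      rw [e]
      exact hKconj _ (inv_mem (hTΓ ha)) _ (inv_mem iha)
  have hST : smallElements Γ ε ⊆ Γ := fun s ⟨_, _, hs⟩ => hs.1
  refine le_trans ?_ (fun k hk => by simpa using hk 1 (one_mem Γ) : K ≤ H)
  rw [Subgroup.commutator_le]
  intro f hf g hg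
  refine hext _ g hST hg (fun s hs => ?_) f (hgen ε hε hf)
  have := hext _ s hST (hST hs) (fun t ht => hsmall t ht s hs) g (hgen ε hε hg)
  rw [← commutatorElement_inv]
  exact inv_mem this

end

/-! ### Invariant measures as limits of empirical measures -/

section

variable {X : Type*} [TopologicalSpace X]

open Classical in
/-- The number of visits to `C` of the orbit segment `y, φ y, …, φ^{L-1} y`. -/
noncomputable def visits (φ : X ≃ₜ X) (C : Set X) (y : X) (L : ℕ) : ℕ :=
  ((Finset.range L).filter fun i => (φ ^ i) y ∈ C).card

theorem visits_eq_sum (φ : X ≃ₜ X) (C : Set X) (y : X) (L : ℕ) :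
    (visits φ C y L : ℝ) = ∑ i ∈ Finset.range L, C.indicator (fun _ => (1 : ℝ)) ((φ ^ i) y) := by
  classical
  rw [visits, Finset.card_filter]
  push_cast
  exact Finset.sum_congr rfl fun i _ => by simp [Set.indicator]

/-- Shifting the orbit segment by one step changes the number of visits by at most one. -/
theorem abs_visits_preimage_sub_le (φ : X ≃ₜ X) (C : Set X) (y : X) (L : ℕ) :
    |(visits φ (φ ⁻¹' C) y L : ℝ) - visits φ C y L| ≤ 1 := by
  have h1 : (visits φ (φ ⁻¹' C) y L : ℝ) =
      ∑ i ∈ Finset.range L, C.indicator (fun _ => (1 : ℝ)) ((φ ^ (i + 1)) y) := by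
    rw [visits_eq_sum]
    refine Finset.sum_congr rfl fun i _ => ?_
    rw [pow_succ', Homeomorph.mul_apply]
    rfl
  have h2 := Finset.sum_range_succ' (fun i => C.indicator (fun _ => (1 : ℝ)) ((φ ^ i) y)) L
  rw [Finset.sum_range_succ] at h2
  have h3 : ∀ z, 0 ≤ C.indicator (fun _ => (1 : ℝ)) z ∧ C.indicator (fun _ => (1 : ℝ)) z ≤ 1 := by
    intro z
    by_cases hz : z ∈ C <;> simp [hz]
  rw [h1, visits_eq_sum, abs_le]
  have := h3 ((φ ^ L) y)
  have := h3 ((φ ^ 0) y)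
  constructor <;> linarith

open MeasureTheory Filter

variable [MeasurableSpace X]

/-- The uniform probability measure on the orbit segment `y, φ y, …, φ^{L-1} y`. -/
noncomputable def empiricalMeasure (φ : X ≃ₜ X) (y : X) (L : ℕ) : Measure X :=
  (L : ENNReal)⁻¹ • ∑ i ∈ Finset.range L, Measure.dirac ((φ ^ i) y)

theorem isProbabilityMeasure_empiricalMeasure (φ : X ≃ₜ X) (y : X) {L : ℕ} (hL : 0 < L) :
    IsProbabilityMeasure (empiricalMeasure φ y L) := by
  constructor
  simp only [empiricalMeasure, Measure.smul_apply, Measure.finsetSum_apply, measure_univ,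
    Finset.sum_const, Finset.card_range, nsmul_eq_mul, mul_one, smul_eq_mul]
  exact ENNReal.inv_mul_cancel (by simpa using hL.ne') (by simp)

theorem empiricalMeasure_real (φ : X ≃ₜ X) (y : X) (L : ℕ) {C : Set X} (hC : MeasurableSet C) :
    (empiricalMeasure φ y L).real C = (L : ℝ)⁻¹ * visits φ C y L := by
  rw [empiricalMeasure, measureReal_def, Measure.smul_apply, Measure.finsetSum_apply, smul_eq_mul,
    ENNReal.toReal_mul, ENNReal.toReal_sum (by simp), visits_eq_sum]
  congr 1
  · simp
  · refine Finset.sum_congr rfl fun i _ => ?_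
    rw [Measure.dirac_apply' _ hC]
    by_cases h : (φ ^ i) y ∈ C <;> simp [h]

/-- Along an ultrafilter, the empirical measures of longer and longer orbit segments converge on
clopen sets to an invariant probability measure. -/
theorem exists_invariant_limit_measure [BorelSpace X] [CompactSpace X]
    [TopologicalSpace.MetrizableSpace X]
    (hB : TopologicalSpace.IsTopologicalBasis {s : Set X | IsClopen s})
    (φ : X ≃ₜ X) (y : ℕ → X) {L : ℕ → ℕ} (hpos : ∀ n, 0 < L n) (hL : Tendsto L atTop atTop) :
    ∃ μ : Measure X, IsProbabilityMeasure μ ∧ MeasurePreserving φ μ μ ∧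
      ∀ C, IsClopen C → Tendsto (fun n => ((L n : ℝ))⁻¹ * visits φ C (y n) (L n))
        (hyperfilter ℕ) (𝓝 (μ.real C)) := by
  let P : ℕ → ProbabilityMeasure X := fun n =>
    ⟨empiricalMeasure φ (y n) (L n), isProbabilityMeasure_empiricalMeasure φ (y n) (hpos n)⟩
  obtain ⟨μ, -, hμ⟩ := isCompact_univ.ultrafilter_le_nhds ((hyperfilter ℕ).map P) (by simp)
  have hlim : Tendsto P (hyperfilter ℕ) (𝓝 μ) := hμ
  have hconv : ∀ C, IsClopen C → Tendsto (fun n => ((L n : ℝ))⁻¹ * visits φ C (y n) (L n))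
      (hyperfilter ℕ) (𝓝 ((μ : Measure X).real C)) := by
    intro C hC
    have h1 := ProbabilityMeasure.tendsto_measure_of_isClopen_of_tendsto hlim hC
    have h2 := (NNReal.continuous_coe.tendsto _).comp h1
    refine (h2.congr fun n => ?_)
    rw [← empiricalMeasure_real φ (y n) (L n) hC.isOpen.measurableSet]
    rfl
  refine ⟨μ, inferInstance, ⟨φ.continuous.measurable, ?_⟩, hconv⟩
  -- invariance only has to be checked on clopen sets, where shifting the orbit segments
  -- costs `1 / L n`
  have hpi : IsPiSystem {s : Set X | IsClopen s} := fun s hs t ht _ => IsClopen.inter hs ht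
  have : IsProbabilityMeasure ((μ : Measure X).map φ) :=
    Measure.isProbabilityMeasure_map φ.continuous.measurable.aemeasurable
  refine ext_of_generate_finite _
    (BorelSpace.measurable_eq.trans hB.borel_eq_generateFrom) hpi (fun C hC => ?_) (by simp)
  rw [Measure.map_apply φ.continuous.measurable (IsClopen.isOpen hC).measurableSet]
  have hC' : IsClopen (φ ⁻¹' C) := IsClopen.preimage hC φ.continuous
  rw [← measureReal_eq_measureReal_iff]
  refine tendsto_nhds_unique (hconv _ hC') ?_
  have h0 : Tendsto (fun n => ((L n : ℝ))⁻¹) (hyperfilter ℕ) (𝓝 0) :=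
    ((tendsto_inv_atTop_zero.comp tendsto_natCast_atTop_atTop).comp hL).mono_left
      (Nat.hyperfilter_le_atTop)
  have h3 : Tendsto (fun n => ((L n : ℝ))⁻¹ * visits φ (φ ⁻¹' C) (y n) (L n) -
      ((L n : ℝ))⁻¹ * visits φ C (y n) (L n)) (hyperfilter ℕ) (𝓝 0) := by
    refine squeeze_zero_norm (fun n => ?_) h0
    rw [← mul_sub, norm_mul, Real.norm_eq_abs, Real.norm_eq_abs, abs_of_nonneg (by positivity)]
    exact mul_le_of_le_one_right (by positivity) (abs_visits_preimage_sub_le φ C _ _)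
  simpa using (hconv C hC).add h3

theorem measurePreserving_zpow [BorelSpace X] {φ : X ≃ₜ X} {μ : Measure X}
    (h : MeasurePreserving φ μ μ) (k : ℤ) : MeasurePreserving (φ ^ k : X ≃ₜ X) μ μ := by
  have hinv : MeasurePreserving (φ⁻¹ : X ≃ₜ X) μ μ :=
    MeasurePreserving.symm φ.toMeasurableEquiv h
  induction k using Int.induction_on with
  | zero => exact MeasurePreserving.id μ
  | succ n ih => rw [zpow_add_one]; exact ih.comp h
  | pred n ih => rw [zpow_sub_one]; exact ih.comp hinv

theorem measure_image_zpow [BorelSpace X] {φ : X ≃ₜ X} {μ : Measure X}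
    (h : MeasurePreserving φ μ μ) (k : ℤ) {S : Set X} (hS : MeasurableSet S) :
    μ ((φ ^ k) '' S) = μ S := by
  have := (measurePreserving_zpow h (-k)).measure_preimage hS.nullMeasurableSet
  rw [zpow_neg] at this
  rw [← this]
  exact congrArg μ ((φ ^ k).image_eq_preimage_symm S)

/-- An element of the full group does not increase the invariant measure of a set, because it is
pieced together from countably many powers of `φ`. -/
theorem measure_image_le_of_mem_fullGroup [BorelSpace X] [T2Space X] {φ f : X ≃ₜ X} {μ : Measure X}
    (hap : ∀ (x : X) (k l : ℤ), (φ ^ k) x = (φ ^ l) x → k = l)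
    (h : MeasurePreserving φ μ μ) (hf : f ∈ fullGroup φ) {A : Set X} (hA : MeasurableSet A) :
    μ (f '' A) ≤ μ A := by
  let E : ℤ → Set X := fun k => A ∩ {x | f x = (φ ^ k) x}
  have hE : ∀ k, MeasurableSet (E k) := fun k =>
    hA.inter (isClosed_eq f.continuous (φ ^ k).continuous).measurableSet
  have hdisj : Pairwise (Function.onFun Disjoint E) := fun k l hkl =>
    Set.disjoint_left.2 fun x hx hx' => hkl (hap x k l (hx.2.symm.trans hx'.2))
  have hsub : f '' A ⊆ ⋃ k, ⇑(φ ^ k) '' E k := by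
    rintro _ ⟨x, hx, rfl⟩
    obtain ⟨k, hk⟩ := hf x
    exact mem_iUnion.2 ⟨k, x, ⟨hx, hk⟩, hk.symm⟩
  calc μ (f '' A) ≤ μ (⋃ k, ⇑(φ ^ k) '' E k) := measure_mono hsub
    _ ≤ ∑' k, μ (⇑(φ ^ k) '' E k) := measure_iUnion_le _
    _ = ∑' k, μ (E k) := tsum_congr fun k => measure_image_zpow h k (hE k)
    _ = μ (⋃ k, E k) := (measure_iUnion hdisj hE).symm
    _ ≤ μ A := measure_mono (iUnion_subset fun k => inter_subset_left)

end

/-! ### Greedy matching and return times -/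

section

variable {X : Type*} [TopologicalSpace X]

/-- A maximal partial matching between disjoint clopen sets `A` and `B`, using the powers `φ ^ k`
with `k` in a given list. It is encoded by an element `p` that exchanges matched points and fixes
unmatched ones. The list is processed greedily: for each `k`, all pairs `x ∈ A`, `φ ^ k x ∈ B` that
are still unmatched get matched. -/
theorem exists_greedy_matching {Γ T : Subgroup (X ≃ₜ X)}
    (hT : ∀ γ ∈ Γ, ∀ (A : Set X) (hA : IsClopen A) (hd : ∀ x ∈ A, γ x ∉ A),
      swapHomeo γ A hA hd ∈ T)
    {φ : X ≃ₜ X} (hφ : φ ∈ Γ) {A B : Set X} (hA : IsClopen A) (hB : IsClopen B)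
    (hAB : Disjoint A B) (ks : List ℤ) :
    ∃ p ∈ T, (∀ x, x ∉ A → x ∉ B → p x = x) ∧
      (∀ x ∈ A, p x ≠ x → p x ∈ B ∧ ∃ k ∈ ks, p x = (φ ^ k) x) ∧
      (∀ b ∈ B, p b ≠ b → ∃ x ∈ A, p x = b) ∧
      ∀ k ∈ ks, ∀ x ∈ A, (φ ^ k) x ∈ B → p x ≠ x ∨ p ((φ ^ k) x) ≠ (φ ^ k) x := by
  have hAB' : ∀ x ∈ A, x ∉ B := fun x hx hx' => Set.disjoint_left.1 hAB hx hx'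
  induction ks with
  | nil => exact ⟨1, one_mem _, fun _ _ _ => rfl, fun x _ h => absurd rfl h,
      fun b _ h => absurd rfl h, by simp⟩
  | cons k ks ih =>
    obtain ⟨p, hp, h1, h2, h3, h4⟩ := ih
    -- `C` is the set of unmatched points of `A` to be matched along `φ ^ k`; matched points of
    -- `A` are mapped into `B` by `p` and conversely, so that being unmatched is a clopen condition
    let C : Set X := (A ∩ p ⁻¹' A) ∩ (φ ^ k) ⁻¹' (B ∩ p.symm ⁻¹' B)
    have hC : IsClopen C := (hA.inter (hA.preimage p.continuous)).inter
      ((hB.inter (hB.preimage p.symm.continuous)).preimage (φ ^ k).continuous)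
    have memC : ∀ x, x ∈ C ↔ x ∈ A ∧ p x = x ∧ (φ ^ k) x ∈ B ∧ p ((φ ^ k) x) = (φ ^ k) x := by
      intro x
      constructor
      · rintro ⟨⟨hx, hpx⟩, hb, hpb⟩
        refine ⟨hx, ?_, hb, ?_⟩
        · by_contra h
          exact hAB' _ hpx (h2 x hx h).1
        · by_contra h
          obtain ⟨a, ha, hab⟩ := h3 _ hb h
          refine hAB' a ha ?_
          have : p.symm ((φ ^ k) x) = a := by rw [← hab, p.symm_apply_apply]
          exact this ▸ hpb
      · rintro ⟨hx, hpx, hb, hpb⟩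
        refine ⟨⟨hx, show p x ∈ A by rwa [hpx]⟩, hb, ?_⟩
        change p.symm ((φ ^ k) x) ∈ B
        rwa [(p.symm_apply_eq).2 hpb.symm]
    have hd : ∀ x ∈ C, (φ ^ k) x ∉ C := fun x hx hx' =>
      hAB' _ ((memC _).1 hx').1 ((memC x).1 hx).2.2.1
    let s := swapHomeo (φ ^ k) C hC hd
    have hs1 : ∀ x ∈ C, s x = (φ ^ k) x := fun x hx => swapHomeo_of_mem hx
    -- the swap fixes points outside `C` that are not unmatched points of `B`
    have hs2 : ∀ x, x ∉ C → (x ∈ B → p x ≠ x) → s x = x := by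
      intro x hx hxB
      refine swapHomeo_of_notMem hx fun h => ?_
      have := (memC _).1 h
      rw [(φ ^ k).apply_symm_apply] at this
      exact hxB this.2.2.1 this.2.2.2
    have hold : ∀ x ∈ A, p x ≠ x → s (p x) = p x := fun x hx hpx =>
      hs2 _ (fun h => hAB' _ ((memC _).1 h).1 (h2 x hx hpx).1) fun _ h => hpx (p.injective h)
    have hstay : ∀ x ∈ A, x ∉ C → p x = x → s (p x) = x := by
      intro x hx hxC hpx
      rw [hpx]
      exact hs2 x hxC fun hxB => absurd hxB (hAB' x hx)
    have mono1 : ∀ x ∈ A, p x ≠ x → (s * p) x ≠ x := by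
      intro x hx hpx
      rwa [Homeomorph.mul_apply, hold x hx hpx]
    have mono2 : ∀ b ∈ B, p b ≠ b → (s * p) b ≠ b := by
      intro b hb hpb h
      obtain ⟨a, ha, hab⟩ := h3 b hb hpb
      have hne : p a ≠ a := fun h' => hAB' a ha (by rw [← h', hab]; exact hb)
      have h5 : (s * p) a = b := by rw [Homeomorph.mul_apply, hold a ha hne, hab]
      exact hAB' a ha ((s * p).injective (h5.trans h.symm) ▸ hb)
    refine ⟨s * p, mul_mem (hT _ (zpow_mem hφ k) C hC hd) hp, ?_, ?_, ?_, ?_⟩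
    · intro x hxA hxB
      rw [Homeomorph.mul_apply, h1 x hxA hxB]
      exact hs2 x (fun h => hxA ((memC x).1 h).1) fun h => absurd h hxB
    · intro x hx hne
      rw [Homeomorph.mul_apply] at hne ⊢
      by_cases hpx : p x = x
      · by_cases hxC : x ∈ C
        · rw [hpx, hs1 x hxC]
          exact ⟨((memC x).1 hxC).2.2.1, k, by simp, rfl⟩
        · exact absurd (hstay x hx hxC hpx) hne
      · rw [hold x hx hpx]
        obtain ⟨hb, l, hl, hpl⟩ := h2 x hx hpx
        exact ⟨hb, l, by simp [hl], hpl⟩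
    · intro b hb hne
      by_cases hpb : p b = b
      · have hbC : (φ ^ k).symm b ∈ C := by
          by_contra h
          refine hne ?_
          rw [Homeomorph.mul_apply, hpb]
          exact swapHomeo_of_notMem (fun h => hAB' b ((memC b).1 h).1 hb) h
        have h5 := (memC _).1 hbC
        refine ⟨_, h5.1, ?_⟩
        rw [Homeomorph.mul_apply, h5.2.1, hs1 _ hbC, (φ ^ k).apply_symm_apply]
      · obtain ⟨a, ha, hab⟩ := h3 b hb hpb
        have hne : p a ≠ a := fun h' => hAB' a ha (by rw [← h', hab]; exact hb)
        exact ⟨a, ha, by rw [Homeomorph.mul_apply, hold a ha hne, hab]⟩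
    · intro l hl x hx hlx
      rcases List.mem_cons.1 hl with rfl | hl
      · by_cases hpx : p x = x
        · by_cases hpb : p ((φ ^ l) x) = (φ ^ l) x
          · left
            have hxC : x ∈ C := (memC x).2 ⟨hx, hpx, hlx, hpb⟩
            rw [Homeomorph.mul_apply, hpx, hs1 x hxC]
            exact fun h => hAB' x hx (h ▸ hlx)
          · exact Or.inr (mono2 _ hlx hpb)
        · exact Or.inl (mono1 x hx hpx)
      · rcases h4 l hl x hx hlx with h | h
        · exact Or.inl (mono1 x hx h)
        · exact Or.inr (mono2 _ hlx h)

/-- If some point `x` of `A` is left unmatched by the powers `φ ^ k`, `|k| ≤ n`, then all visits of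
its orbit to `B` during the time `[0, n)` are matched with visits to `A` during `[-n, 2n)`. -/
theorem exists_matching_or_visits_le {Γ T : Subgroup (X ≃ₜ X)}
    (hT : ∀ γ ∈ Γ, ∀ (A : Set X) (hA : IsClopen A) (hd : ∀ x ∈ A, γ x ∉ A),
      swapHomeo γ A hA hd ∈ T)
    {φ : X ≃ₜ X} (hφ : φ ∈ Γ)
    (hap : ∀ (x : X) (k l : ℤ), (φ ^ k) x = (φ ^ l) x → k = l)
    {A B : Set X} (hA : IsClopen A) (hB : IsClopen B) (hAB : Disjoint A B) (n : ℕ) :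
    (∃ p ∈ T, (∀ x, x ∉ A → x ∉ B → p x = x) ∧ ∀ x ∈ A, p x ∈ B) ∨
      ∃ x y : X, visits φ B x n ≤ visits φ A y (3 * n) := by
  classical
  obtain ⟨p, hp, h1, h2, h3, h4⟩ := exists_greedy_matching hT hφ hA hB hAB
    (Finset.Icc (-n : ℤ) n).toList
  by_cases hall : ∀ x ∈ A, p x ≠ x
  · exact Or.inl ⟨p, hp, h1, fun x hx => (h2 x hx (hall x hx)).1⟩
  · right
    push Not at hall
    obtain ⟨x, hx, hpx⟩ := hall
    refine ⟨x, (φ ^ (-n : ℤ)) x, ?_⟩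
    rw [visits, visits]
    refine Finset.card_le_card_of_forall_subsingleton
      (fun i j => p ((φ ^ j) ((φ ^ (-n : ℤ)) x)) = (φ ^ i) x) ?_ ?_
    · intro i hi
      rw [Finset.mem_filter, Finset.mem_range] at hi
      obtain ⟨hi, hiB⟩ := hi
      rw [← zpow_natCast] at hiB
      have hb := (h4 i (by simp; omega) x hx hiB).resolve_left (by simpa using hpx)
      obtain ⟨a, ha, hab⟩ := h3 _ hiB hb
      have hne : p a ≠ a := fun h' => Set.disjoint_left.1 hAB ha (by rw [← h', hab]; exact hiB)
      obtain ⟨-, k, hk, hak⟩ := h2 a ha hne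
      simp only [Finset.mem_toList, Finset.mem_Icc] at hk
      obtain ⟨j, hj⟩ : ∃ j : ℕ, (j : ℤ) = i - k + n := ⟨(i - k + n).toNat, by omega⟩
      have hja : (φ ^ j) ((φ ^ (-n : ℤ)) x) = a := by
        rw [← zpow_natCast, ← Homeomorph.mul_apply, ← zpow_add, hj,
          show (i - k + n + -n : ℤ) = -k + i by ring, zpow_add, Homeomorph.mul_apply, ← hab, hak,
          ← Homeomorph.mul_apply, ← zpow_add, neg_add_cancel, zpow_zero]
        rfl
      refine ⟨j, ?_, ?_⟩
      · rw [Finset.mem_filter, Finset.mem_range, hja]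
        exact ⟨by omega, ha⟩
      · rw [hja, hab, zpow_natCast]
    · intro j _ i hi i' hi'
      have := hi.2.symm.trans hi'.2
      rw [← zpow_natCast, ← zpow_natCast] at this
      exact_mod_cast hap x i i' this

/-- A minimal homeomorphism of a compact space visits a nonempty open set within a uniformly bounded
time. -/
theorem exists_uniform_return [CompactSpace X] {φ : X ≃ₜ X} (hmin : IsMinimalHomeo φ) {Z : Set X}
    (hZ : IsOpen Z) (hne : Z.Nonempty) : ∃ N : ℕ, ∀ x, ∃ j < N, (φ ^ j) x ∈ Z := by
  obtain ⟨t, ht⟩ := isCompact_univ.elim_finite_subcover (fun k : ℤ => (φ ^ k) ⁻¹' Z)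
    (fun k => hZ.preimage (φ ^ k).continuous) (fun x _ => by
      obtain ⟨_, hz, k, rfl⟩ := (hmin x).inter_open_nonempty Z hZ hne
      exact mem_iUnion.2 ⟨k, hz⟩)
  let m : ℕ := t.sup Int.natAbs
  refine ⟨2 * m + 1, fun x => ?_⟩
  obtain ⟨k, hk, hkx⟩ := mem_iUnion₂.1 (ht (mem_univ ((φ ^ (m : ℤ)) x)))
  have hkm : k.natAbs ≤ m := Finset.le_sup hk
  obtain ⟨j, hj⟩ : ∃ j : ℕ, (j : ℤ) = k + m := ⟨(k + m).toNat, by omega⟩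
  refine ⟨j, by omega, ?_⟩
  rw [← zpow_natCast, hj, zpow_add]
  exact hkx

/-- In an aperiodic system, every point has an open neighbourhood that does not return to itself
before time `N`. -/
theorem exists_open_no_return [T2Space X] {φ : X ≃ₜ X}
    (hap : ∀ (x : X) (k l : ℤ), (φ ^ k) x = (φ ^ l) x → k = l) (x : X) (N : ℕ) :
    ∃ O : Set X, IsOpen O ∧ x ∈ O ∧ ∀ y ∈ O, ∀ i, 0 < i → i < N → (φ ^ i) y ∉ O := by
  induction N with
  | zero => exact ⟨univ, isOpen_univ, mem_univ x, fun _ _ i _ hi => absurd hi (by omega)⟩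
  | succ N ih =>
    obtain ⟨O, hO, hxO, h⟩ := ih
    rcases Nat.eq_zero_or_pos N with rfl | hN
    · exact ⟨univ, isOpen_univ, mem_univ x, fun _ _ i _ hi => absurd hi (by omega)⟩
    have hne : (φ ^ N) x ≠ x := fun h => by
      have := hap x N 0 (by rw [zpow_natCast, h]; rfl)
      omega
    obtain ⟨U, V, hU, hV, hxU, hxV, hUV⟩ := t2_separation hne
    refine ⟨O ∩ V ∩ (φ ^ N) ⁻¹' U, (hO.inter hV).inter (hU.preimage (φ ^ N).continuous),
      ⟨⟨hxO, hxV⟩, hxU⟩, fun y hy i hi hiN hiy => ?_⟩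
    rcases Nat.lt_succ_iff_lt_or_eq.1 hiN with hi' | rfl
    · exact h y hy.1.1 i hi hi' hiy.1.1
    · exact Set.disjoint_left.1 hUV hy.2 hiy.1.2

/-- Powers of a minimal homeomorphism of an infinite space have no fixed points. -/
theorem IsMinimalHomeo.aperiodic [T1Space X] [Infinite X] {φ : X ≃ₜ X} (hmin : IsMinimalHomeo φ)
    (x : X) (k l : ℤ) (h : (φ ^ k) x = (φ ^ l) x) : k = l := by
  by_contra hkl
  have hm : ∃ m : ℤ, 0 < m ∧ (φ ^ m) x = x := by
    have key : ∀ k l : ℤ, (φ ^ k) x = (φ ^ l) x → (φ ^ (k - l)) x = x := by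
      intro k l h
      rw [sub_eq_neg_add, zpow_add, Homeomorph.mul_apply, h, ← Homeomorph.mul_apply, ← zpow_add,
        neg_add_cancel, zpow_zero]
      rfl
    rcases lt_or_gt_of_ne hkl with h' | h'
    · exact ⟨l - k, by omega, key l k h.symm⟩
    · exact ⟨k - l, by omega, key k l h⟩
  obtain ⟨m, hm, hmx⟩ := hm
  have hmul : ∀ q : ℤ, ((φ ^ m) ^ q) x = x := fun q => by
    induction q using Int.induction_on with
    | zero => rfl
    | succ n ih => rw [zpow_add_one, Homeomorph.mul_apply, hmx, ih]
    | pred n ih =>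
      rw [zpow_sub_one, Homeomorph.mul_apply, Homeomorph.inv_apply,
        (φ ^ m).symm_apply_eq.2 hmx.symm, ih]
  have hfin : (homeoOrbit φ x).Finite := by
    refine ((Set.finite_Ico 0 m).image fun i => (φ ^ i) x).subset ?_
    rintro _ ⟨n, rfl⟩
    refine ⟨n % m, ⟨Int.emod_nonneg _ hm.ne', Int.emod_lt_of_pos _ hm⟩, ?_⟩
    conv_rhs => rw [← Int.emod_add_mul_ediv n m, zpow_add, zpow_mul, Homeomorph.mul_apply, hmul]
  have huniv : homeoOrbit φ x = univ := by
    rw [← hfin.isClosed.closure_eq]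
    exact (hmin x).closure_eq
  exact Set.infinite_univ (huniv ▸ hfin)

end

/-! ### Generation by elements of small support -/

section

variable {X : Type*} [TopologicalSpace X]

open MeasureTheory Filter in
/-- The part of `Z` outside `f(A)` is large enough to receive `A`, provided that `A` returns to
itself only after a long time: an invariant measure gives mass at most `1 / N` to `A` and to `f(A)`,
but mass at least `1 / N₀` to `Z`. -/
theorem exists_map_into_sdiff_image [CompactSpace X] [TopologicalSpace.MetrizableSpace X]
    (hbas : TopologicalSpace.IsTopologicalBasis {s : Set X | IsClopen s})
    {Γ T : Subgroup (X ≃ₜ X)}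
    (hT : ∀ γ ∈ Γ, ∀ (A : Set X) (hA : IsClopen A) (hd : ∀ x ∈ A, γ x ∉ A),
      swapHomeo γ A hA hd ∈ T)
    {φ : X ≃ₜ X} (hφ : φ ∈ Γ)
    (hap : ∀ (x : X) (k l : ℤ), (φ ^ k) x = (φ ^ l) x → k = l)
    {f : X ≃ₜ X} (hf : f ∈ fullGroup φ) {A Z : Set X} (hA : IsClopen A) (hZ : IsClopen Z)
    (hAZ : Disjoint A Z) {N₀ N : ℕ} (hN₀ : ∀ x, ∃ j < N₀, (φ ^ j) x ∈ Z) (hN : 4 * N₀ < N)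
    (hAN : ∀ y ∈ A, ∀ i, 0 < i → i < N → (φ ^ i) y ∉ A) :
    ∃ p ∈ T, (∀ x, x ∉ A → x ∉ Z → p x = x) ∧ ∀ x ∈ A, p x ∈ Z ∧ p x ∉ f '' A := by
  have hfA : IsClopen (f '' A) := by
    rw [f.image_eq_preimage_symm]
    exact hA.preimage f.symm.continuous
  set B := Z \ f '' A with hBdef
  have hB : IsClopen B := hZ.diff hfA
  have hAB : Disjoint A B := hAZ.mono_right sdiff_subset
  by_contra hno
  have hvis : ∀ n : ℕ, ∃ x y : X, visits φ B x n ≤ visits φ A y (3 * n) := by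
    intro n
    refine (exists_matching_or_visits_le hT hφ hap hA hB hAB n).resolve_left ?_
    rintro ⟨p, hp, h1, h2⟩
    exact hno ⟨p, hp, fun x hxA hxZ => h1 x hxA fun h => hxZ h.1, fun x hx => h2 x hx⟩
  -- orbit segments of length `n + 1` and `3 (n + 1)` yield limit measures `μ` and `ν` with
  -- `μ(B) ≤ 3 ν(A)`
  choose x y hxy using fun n => hvis (n + 1)
  borelize X
  obtain ⟨μ, hμ, hμφ, hμlim⟩ := exists_invariant_limit_measure hbas φ x (L := fun n => n + 1)
    (fun n => n.succ_pos) (tendsto_add_atTop_nat 1)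
  obtain ⟨ν, hν, hνφ, hνlim⟩ := exists_invariant_limit_measure hbas φ y
    (L := fun n => 3 * (n + 1)) (fun n => by positivity)
    (tendsto_atTop_mono (fun n => show n ≤ 3 * (n + 1) by omega) tendsto_id)
  have hBA : μ.real B ≤ 3 * ν.real A := by
    refine le_of_tendsto_of_tendsto' (hμlim B hB) ((hνlim A hA).const_mul 3) fun n => ?_
    have h1 : (visits φ B (x n) (n + 1) : ℝ) ≤ visits φ A (y n) (3 * (n + 1)) := by
      exact_mod_cast hxy n
    push_cast
    rw [mul_inv, ← mul_assoc, ← mul_assoc, mul_inv_cancel₀ (by norm_num : (3 : ℝ) ≠ 0), one_mul]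
    gcongr
  have hsmall : ∀ μ : Measure X, IsProbabilityMeasure μ → MeasurePreserving φ μ μ →
      (N : ℝ) * μ.real A ≤ 1 := by
    intro μ hμ hμφ
    have hpre : ∀ i : ℕ, μ.real ((φ ^ i) ⁻¹' A) = μ.real A := fun i => by
      rw [← zpow_natCast, measureReal_def, (measurePreserving_zpow hμφ i).measure_preimage
        hA.isOpen.measurableSet.nullMeasurableSet, measureReal_def]
    have hdis : ∀ i < N, ∀ j < N, i < j → Disjoint ((φ ^ i) ⁻¹' A) ((φ ^ j) ⁻¹' A) := by
      intro i _ j hj hij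
      refine Set.disjoint_left.2 fun z hz hz' => hAN _ hz (j - i) (by omega) (by omega) ?_
      rw [← Homeomorph.mul_apply, ← pow_add, Nat.sub_add_cancel hij.le]
      exact hz'
    have := measureReal_biUnion_finset (μ := μ) (s := Finset.range N)
      (f := fun i => (φ ^ i) ⁻¹' A) (fun i hi j hj hij => by
        simp only [Finset.coe_range, mem_Iio] at hi hj
        rcases lt_or_gt_of_ne hij with h | h
        · exact hdis i hi j hj h
        · exact (hdis j hj i hi h).symm)
      (fun i _ => (hA.isOpen.preimage (φ ^ i).continuous).measurableSet)
    simp only [hpre, Finset.sum_const, Finset.card_range, nsmul_eq_mul] at this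
    rw [← this]
    exact measureReal_le_one
  have hlarge : 1 ≤ (N₀ : ℝ) * μ.real Z := by
    have hpre : ∀ i : ℕ, μ.real ((φ ^ i) ⁻¹' Z) = μ.real Z := fun i => by
      rw [← zpow_natCast, measureReal_def, (measurePreserving_zpow hμφ i).measure_preimage
        hZ.isOpen.measurableSet.nullMeasurableSet, measureReal_def]
    have h1 := measureReal_biUnion_finset_le (μ := μ) (Finset.range N₀)
      (fun i => (φ ^ i) ⁻¹' Z)
    have h2 : (⋃ i ∈ Finset.range N₀, (φ ^ i) ⁻¹' Z) = univ := by
      refine eq_univ_of_forall fun z => ?_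
      obtain ⟨j, hj, hjz⟩ := hN₀ z
      exact mem_iUnion₂.2 ⟨j, by simpa using hj, hjz⟩
    rw [h2, probReal_univ] at h1
    simpa only [hpre, Finset.sum_const, Finset.card_range, nsmul_eq_mul] using h1
  have hfle : μ.real (f '' A) ≤ μ.real A := ENNReal.toReal_mono (measure_ne_top μ A)
    (measure_image_le_of_mem_fullGroup hap hμφ hf hA.isOpen.measurableSet)
  have hsplit : μ.real Z ≤ μ.real B + μ.real (f '' A) := by
    refine (measureReal_mono (s₂ := B ∪ f '' A) ?_).trans (measureReal_union_le _ _)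
    intro z hz
    by_cases h : z ∈ f '' A
    · exact Or.inr h
    · exact Or.inl ⟨hz, h⟩
  have hμA := hsmall μ hμ hμφ
  have hνA := hsmall ν hν hνφ
  have hN' : (4 * N₀ : ℝ) + 1 ≤ N := by exact_mod_cast hN
  have h0 : (0 : ℝ) ≤ N₀ := Nat.cast_nonneg _
  have hZ4 : μ.real Z ≤ 3 * ν.real A + μ.real A := by linarith
  -- `N ≤ N N₀ μ(Z) ≤ N₀ (3 N ν(A) + N μ(A)) ≤ 4 N₀ < N`
  have h5 : (N : ℝ) * 1 ≤ N * (N₀ * μ.real Z) := by gcongr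
  have h6 : (N : ℝ) * (N₀ * μ.real Z) ≤ N * (N₀ * (3 * ν.real A + μ.real A)) := by gcongr
  have h7 : (N₀ : ℝ) * (3 * (N * ν.real A) + N * μ.real A) ≤ N₀ * (3 * 1 + 1) := by gcongr
  linarith

/-- If every point has a clopen neighbourhood all of whose clopen subsets `Q` have the swap of `Q`
and `f(Q)` in `T`, then all swaps along `f` are in `T`: a swap is a finite product of such
swaps. -/
theorem swapHomeo_mem_of_local [CompactSpace X] {T : Subgroup (X ≃ₜ X)} {f : X ≃ₜ X}
    (hloc : ∀ x, ∃ C : Set X, IsClopen C ∧ x ∈ C ∧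
      ∀ (Q : Set X) (hQ : IsClopen Q) (hd : ∀ x ∈ Q, f x ∉ Q), Q ⊆ C → swapHomeo f Q hQ hd ∈ T)
    (A : Set X) (hA : IsClopen A) (hd : ∀ x ∈ A, f x ∉ A) : swapHomeo f A hA hd ∈ T := by
  have key : ∃ C : Set X, IsClopen C ∧ (univ : Set X) ⊆ C ∧
      ∀ (Q : Set X) (hQ : IsClopen Q) (hd : ∀ x ∈ Q, f x ∉ Q), Q ⊆ C →
        swapHomeo f Q hQ hd ∈ T := by
    refine IsCompact.induction_on (p := fun s => ∃ C : Set X, IsClopen C ∧ s ⊆ C ∧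
      ∀ (Q : Set X) (hQ : IsClopen Q) (hd : ∀ x ∈ Q, f x ∉ Q), Q ⊆ C →
        swapHomeo f Q hQ hd ∈ T) isCompact_univ ?_ ?_ ?_ ?_
    · refine ⟨∅, isClopen_empty, Subset.rfl, fun Q hQ hd hQe => ?_⟩
      have : swapHomeo f Q hQ hd = 1 := Homeomorph.ext fun x =>
        swapHomeo_of_notMem (fun h => hQe h) fun h => hQe h
      rw [this]
      exact one_mem T
    · rintro s t hst ⟨C, hC, htC, h⟩
      exact ⟨C, hC, hst.trans htC, h⟩
    · rintro s t ⟨C, hC, hsC, h⟩ ⟨D, hD, htD, h'⟩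
      refine ⟨C ∪ D, hC.union hD, union_subset_union hsC htD, fun Q hQ hd hQCD => ?_⟩
      have hd1 : ∀ x ∈ Q ∩ C, f x ∉ Q ∩ C := fun x hx hx' => hd x hx.1 hx'.1
      have hd2 : ∀ x ∈ Q \ C, f x ∉ Q \ C := fun x hx hx' => hd x hx.1 hx'.1
      have e : swapHomeo f Q hQ hd =
          swapHomeo f (Q ∩ C) (hQ.inter hC) hd1 * swapHomeo f (Q \ C) (hQ.diff hC) hd2 := by
        refine Homeomorph.ext fun x => ?_
        rw [Homeomorph.mul_apply]
        by_cases hx : x ∈ Q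
        · have hfx : f x ∉ Q := hd x hx
          by_cases hxC : x ∈ C
          · have h1 : f.symm x ∉ Q := fun h => hd _ h (by simpa using hx)
            rw [swapHomeo_of_mem hx, swapHomeo_of_notMem (A := Q \ C) (fun h => h.2 hxC)
              (fun h => h1 h.1), swapHomeo_of_mem (A := Q ∩ C) ⟨hx, hxC⟩]
          · rw [swapHomeo_of_mem hx, swapHomeo_of_mem (A := Q \ C) ⟨hx, hxC⟩,
              swapHomeo_of_notMem (A := Q ∩ C) (fun h => hfx h.1)
                (fun h => hxC (by simpa using h.2))]
        · by_cases hy : f.symm x ∈ Q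
          · by_cases hyC : f.symm x ∈ C
            · rw [swapHomeo_of_symm_mem hy, swapHomeo_of_notMem (A := Q \ C) (fun h => hx h.1)
                (fun h => h.2 hyC), swapHomeo_of_symm_mem (A := Q ∩ C) ⟨hy, hyC⟩]
            · rw [swapHomeo_of_symm_mem hy, swapHomeo_of_symm_mem (A := Q \ C) ⟨hy, hyC⟩]
              refine (swapHomeo_of_notMem (A := Q ∩ C) (fun h => hyC h.2) fun h => ?_).symm
              exact hd _ h.1 (by simpa using hy)
          · rw [swapHomeo_of_notMem hx hy, swapHomeo_of_notMem (A := Q \ C) (fun h => hx h.1)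
              (fun h => hy h.1), swapHomeo_of_notMem (A := Q ∩ C) (fun h => hx h.1)
              (fun h => hy h.1)]
      rw [e]
      exact mul_mem (h _ _ _ inter_subset_right)
        (h' _ _ _ fun x hx => (hQCD hx.1).resolve_left hx.2)
    · intro x _
      obtain ⟨C, hC, hxC, h⟩ := hloc x
      exact ⟨C, mem_nhdsWithin_of_mem_nhds (hC.isOpen.mem_nhds hxC), C, hC, Subset.rfl, h⟩
  obtain ⟨C, -, huC, h⟩ := key
  exact h A hA hd ((subset_univ A).trans huC)

/-- Every `f ∈ Γ` can be corrected by an element of `T` so that it becomes the identity off a given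
nonempty clopen set `Z`, as soon as `T` contains all swaps along elements of `Γ`. The complement
of `Z` is covered by finitely many sets with long return times, which are dealt with one after the
other. -/
theorem exists_mul_eq_id_off [CompactSpace X] [TopologicalSpace.MetrizableSpace X]
    (hbas : TopologicalSpace.IsTopologicalBasis {s : Set X | IsClopen s})
    {Γ T : Subgroup (X ≃ₜ X)} (hTΓ : T ≤ Γ)
    (hT : ∀ γ ∈ Γ, ∀ (A : Set X) (hA : IsClopen A) (hd : ∀ x ∈ A, γ x ∉ A),
      swapHomeo γ A hA hd ∈ T)
    {φ : X ≃ₜ X} (hφ : φ ∈ Γ) (hΓ : Γ ≤ fullGroup φ) (hmin : IsMinimalHomeo φ)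
    (hap : ∀ (x : X) (k l : ℤ), (φ ^ k) x = (φ ^ l) x → k = l)
    {Z : Set X} (hZ : IsClopen Z) (hne : Z.Nonempty) {f : X ≃ₜ X} (hf : f ∈ Γ) :
    ∃ g ∈ T, ∀ x, x ∉ Z → (g * f) x = x := by
  obtain ⟨N₀, hN₀⟩ := exists_uniform_return hmin hZ.isOpen hne
  have key : ∃ C : Set X, IsClopen C ∧ Zᶜ ⊆ C ∧ Disjoint C Z ∧
      ∀ Y : Set X, IsClopen Y → Disjoint Y Z → ∀ f ∈ Γ, (∀ y ∈ Y, f y = y) →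
        ∃ g ∈ T, ∀ y ∈ Y ∪ C, (g * f) y = y := by
    refine IsCompact.induction_on (p := fun s => ∃ C : Set X, IsClopen C ∧ s ⊆ C ∧ Disjoint C Z ∧
      ∀ Y : Set X, IsClopen Y → Disjoint Y Z → ∀ f ∈ Γ, (∀ y ∈ Y, f y = y) →
        ∃ g ∈ T, ∀ y ∈ Y ∪ C, (g * f) y = y) hZ.compl.isClosed.isCompact ?_ ?_ ?_ ?_
    · exact ⟨∅, isClopen_empty, Subset.rfl, empty_disjoint Z, fun Y _ _ f _ hfY =>
        ⟨1, one_mem T, fun y hy => by simpa using hfY y (by simpa using hy)⟩⟩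
    · rintro s t hst ⟨C, hC, htC, h⟩
      exact ⟨C, hC, hst.trans htC, h⟩
    · rintro s t ⟨C, hC, hsC, hCZ, h⟩ ⟨D, hD, htD, hDZ, h'⟩
      refine ⟨C ∪ D, hC.union hD, union_subset_union hsC htD, hCZ.union_left hDZ,
        fun Y hY hYZ f hf hfY => ?_⟩
      obtain ⟨g, hg, hgf⟩ := h Y hY hYZ f hf hfY
      obtain ⟨k, hk, hkf⟩ := h' (Y ∪ C) (hY.union hC) (hYZ.union_left hCZ) (g * f)
        (mul_mem (hTΓ hg) hf) hgf
      exact ⟨k * g, mul_mem hk hg, fun y hy => by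
        rw [mul_assoc]
        exact hkf y (by rwa [union_assoc])⟩
    · intro x hx
      obtain ⟨O, hO, hxO, hON⟩ := exists_open_no_return hap x (4 * N₀ + 1)
      obtain ⟨C, hC, hxC, hCO⟩ := hbas.exists_subset_of_mem_open (u := O ∩ Zᶜ) ⟨hxO, hx⟩
        (hO.inter hZ.compl.isOpen)
      have hC : IsClopen C := hC
      have hCZ : Disjoint C Z := Set.disjoint_left.2 fun y hy => (hCO hy).2
      refine ⟨C, mem_nhdsWithin_of_mem_nhds (hC.isOpen.mem_nhds hxC), C, hC, Subset.rfl, hCZ,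
        fun Y hY hYZ f hf hfY => ?_⟩
      let A := C \ Y
      have hA : IsClopen A := hC.diff hY
      obtain ⟨p, hp, hp1, hp2⟩ := exists_map_into_sdiff_image hbas hT hφ hap (hΓ hf) hA hZ
        (hCZ.mono_left sdiff_subset) hN₀ (Nat.lt_succ_self _)
        (fun y hy i hi hiN h => hON y (hCO hy.1).1 i hi hiN (hCO h.1).1)
      -- `p` carries `A` into `Z \ f(A)`, and the swap `q` carries `p(A)` on to `f(A)`
      have hpA : IsClopen (p '' A) := by
        rw [p.image_eq_preimage_symm]
        exact hA.preimage p.symm.continuous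
      have hd : ∀ z ∈ p '' A, (f * p⁻¹) z ∉ p '' A := by
        rintro _ ⟨a, ha, rfl⟩ ⟨b, hb, hba⟩
        refine (hp2 b hb).2 ⟨a, ha, ?_⟩
        rw [hba]
        simp
      let q := swapHomeo (f * p⁻¹) (p '' A) hpA hd
      have hq : q ∈ T := hT _ (mul_mem hf (inv_mem (hTΓ hp))) _ _ _
      refine ⟨(q * p)⁻¹, inv_mem (mul_mem hq hp), fun y hy => ?_⟩
      suffices h : f y = q (p y) by
        rw [Homeomorph.mul_apply, h]
        exact (q * p).symm_apply_apply y
      by_cases hyY : y ∈ Y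
      · have hyA : y ∉ A := fun h => h.2 hyY
        have hyZ : y ∉ Z := Set.disjoint_left.1 hYZ hyY
        rw [hfY y hyY, hp1 y hyA hyZ]
        refine (swapHomeo_of_notMem ?_ ?_).symm
        · rintro ⟨a, ha, rfl⟩
          exact hyZ (hp2 a ha).1
        · rintro ⟨a, ha, h⟩
          rw [Homeomorph.eq_symm_apply] at h
          have h' : f a = f y := by
            rw [hfY y hyY, ← h]
            simp
          exact hyA (f.injective h' ▸ ha)
      · have hyA : y ∈ A := ⟨hy.resolve_left hyY, hyY⟩
        have h : q (p y) = (f * p⁻¹) (p y) := swapHomeo_of_mem (mem_image_of_mem p hyA)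
        rw [h]
        simp
  obtain ⟨C, -, hZC, -, h⟩ := key
  obtain ⟨g, hg, hgf⟩ := h ∅ isClopen_empty (empty_disjoint Z) f hf (by simp)
  exact ⟨g, hg, fun x hx => hgf x (Or.inr (hZC hx))⟩

end

/-- A swap-closed group between `⟨φ⟩` and the full group of a minimal homeomorphism `φ` is generated
by its elements of small support. -/
theorem le_closure_smallElements {X : Type*} [MetricSpace X] [CompactSpace X] [Nonempty X]
    (hbas : TopologicalSpace.IsTopologicalBasis {s : Set X | IsClopen s})
    {Γ : Subgroup (X ≃ₜ X)} (hswap : SwapClosed Γ) {φ : X ≃ₜ X} (hφ : φ ∈ Γ)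
    (hΓ : Γ ≤ fullGroup φ) (hmin : IsMinimalHomeo φ)
    (hap : ∀ (x : X) (k l : ℤ), (φ ^ k) x = (φ ^ l) x → k = l) {ε : ℝ} (hε : 0 < ε) :
    Γ ≤ Subgroup.closure (smallElements Γ ε) := by
  have hTΓ : Subgroup.closure (smallElements Γ ε) ≤ Γ :=
    (Subgroup.closure_le Γ).2 fun s ⟨_, _, hs⟩ => hs.1
  have hT : ∀ γ ∈ Γ, ∀ (A : Set X) (hA : IsClopen A) (hd : ∀ x ∈ A, γ x ∉ A),
      swapHomeo γ A hA hd ∈ Subgroup.closure (smallElements Γ ε) := by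
    intro γ hγ
    refine swapHomeo_mem_of_local fun x => ?_
    obtain ⟨C, hC, hxC, hCb⟩ := hbas.exists_subset_of_mem_open
      (u := Metric.ball x ε ∩ γ ⁻¹' Metric.ball (γ x) ε)
      ⟨Metric.mem_ball_self hε, Metric.mem_ball_self hε⟩
      (Metric.isOpen_ball.inter (Metric.isOpen_ball.preimage γ.continuous))
    refine ⟨C, hC, hxC, fun Q hQ hd hQC => Subgroup.subset_closure
      ⟨x, γ x, hswap γ hγ Q hQ hd, fun y hy => swapHomeo_of_notMem ?_ ?_⟩⟩
    · exact fun h => hy (Or.inl (hCb (hQC h)).1)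
    · exact fun h => hy (Or.inr (by simpa using (hCb (hQC h)).2))
  intro f hf
  obtain ⟨z⟩ := ‹Nonempty X›
  obtain ⟨Z, hZ, hzZ, hZb⟩ := hbas.exists_subset_of_mem_open (u := Metric.ball z ε)
    (Metric.mem_ball_self hε) Metric.isOpen_ball
  obtain ⟨g, hg, hgf⟩ := exists_mul_eq_id_off hbas hTΓ hT hφ hΓ hmin hap hZ ⟨z, hzZ⟩ hf
  have h1 : g * f ∈ Subgroup.closure (smallElements Γ ε) := Subgroup.subset_closure
    ⟨z, z, mul_mem (hTΓ hg) hf, fun x hx => hgf x fun h => hx (Or.inl (hZb h))⟩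
  simpa using mul_mem (inv_mem hg) h1

/-! ### The full group and the topological full group -/

section

variable {X : Type*} [TopologicalSpace X]

theorem swapClosed_fullGroup (φ : X ≃ₜ X) : SwapClosed (fullGroup φ) := by
  intro γ hγ A hA hd x
  by_cases hx : x ∈ A
  · rw [swapHomeo_of_mem hx]
    exact hγ x
  · by_cases hy : γ.symm x ∈ A
    · rw [swapHomeo_of_symm_mem hy]
      exact inv_mem hγ x
    · rw [swapHomeo_of_notMem hx hy]
      exact ⟨0, rfl⟩

theorem swapClosed_topologicalFullGroup (φ : X ≃ₜ X) : SwapClosed (topologicalFullGroup φ) := by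
  classical
  intro γ hγ A hA hd
  refine ⟨swapClosed_fullGroup φ γ hγ.1 A hA hd, ?_⟩
  obtain ⟨n, hnc, hn⟩ := hγ.2
  obtain ⟨m, hmc, hm⟩ := (inv_mem hγ).2
  have hA' : IsClopen (γ.symm ⁻¹' A) := hA.preimage γ.symm.continuous
  refine ⟨fun x => if x ∈ A then n x else if γ.symm x ∈ A then m x else 0, ?_, fun x => ?_⟩
  · refine Continuous.if (fun a ha => ?_) hnc
      (Continuous.if (fun a ha => ?_) hmc continuous_const)
    · exact absurd (hA.frontier_eq ▸ ha : a ∈ (∅ : Set X)) (notMem_empty a)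
    · exact absurd (hA'.frontier_eq ▸ ha : a ∈ (∅ : Set X)) (notMem_empty a)
  · beta_reduce
    by_cases hx : x ∈ A
    · rw [swapHomeo_of_mem hx, hn x, if_pos hx]
    · by_cases hy : γ.symm x ∈ A
      · rw [swapHomeo_of_symm_mem hy, if_neg hx, if_pos hy]
        exact hm x
      · rw [swapHomeo_of_notMem hx hy, if_neg hx, if_neg hy]
        rfl

theorem self_mem_topologicalFullGroup (φ : X ≃ₜ X) : φ ∈ topologicalFullGroup φ :=
  ⟨fun _ => ⟨1, by rw [zpow_one]⟩, fun _ => 1, continuous_const, fun _ => by rw [zpow_one]⟩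

/-- The dynamical core of the theorem, for a swap-closed group `Γ` between `⟨φ⟩` and the full
group. -/
theorem IsCantorMinimalSystem.commutator_le {φ : X ≃ₜ X} (h : IsCantorMinimalSystem X φ)
    {Γ : Subgroup (X ≃ₜ X)} (hswap : SwapClosed Γ) (hφ : φ ∈ Γ) (hΓ : Γ ≤ fullGroup φ) :
    ⁅Γ, Γ⁆ ≠ ⊥ ∧ ∀ H ≤ Γ, (∀ d ∈ ⁅Γ, Γ⁆, ∀ h ∈ H, d * h * d⁻¹ ∈ H) → H ≠ ⊥ → ⁅Γ, Γ⁆ ≤ H := by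
  obtain ⟨⟨hne, hc, hmet, hbas, hperf⟩, hmin⟩ := h
  let _ : MetricSpace X := TopologicalSpace.metrizableSpaceMetric X
  obtain ⟨x⟩ := hne
  have hX : Nonempty X := ⟨x⟩
  have hinf : Infinite X :=
    Set.infinite_univ_iff.1 (infinite_of_mem_nhds x Filter.univ_mem)
  have hgmin : IsMinimalGroup Γ := by
    intro x V hV hne
    obtain ⟨_, hv, k, rfl⟩ := (hmin x).inter_open_nonempty V hV hne
    exact ⟨φ ^ k, zpow_mem hφ k, hv⟩
  refine ⟨fun hbot => ?_, fun H hH hD hne => ?_⟩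
  · obtain ⟨d, hd, -, hdx, -⟩ := exists_commutator_move_point hbas hswap hgmin isOpen_univ
      ⟨x, mem_univ x⟩ finite_empty (notMem_empty x)
    rw [hbot, Subgroup.mem_bot] at hd
    exact hdx (by rw [hd]; rfl)
  · exact commutator_le_of_normalized hbas hswap hgmin
      (fun ε hε => le_closure_smallElements hbas hswap hφ hΓ hmin hmin.aperiodic hε) hH hD hne

end

section

variable {G : Type*} [Group G]

theorem map_subtype_commutator (Γ : Subgroup G) :
    (commutator Γ).map Γ.subtype = ⁅Γ, Γ⁆ := by
  rw [commutator_def, Subgroup.map_commutator, ← MonoidHom.range_eq_map, Subgroup.range_subtype]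

/-- Translation of a statement about subgroups of the ambient group into statements about normal
subgroups of `Γ` and of its commutator subgroup. -/
theorem commutator_le_and_isSimpleGroup {Γ : Subgroup G} (hne : ⁅Γ, Γ⁆ ≠ ⊥)
    (h : ∀ H ≤ Γ, (∀ d ∈ ⁅Γ, Γ⁆, ∀ h ∈ H, d * h * d⁻¹ ∈ H) → H ≠ ⊥ → ⁅Γ, Γ⁆ ≤ H) :
    ((∀ H : Subgroup Γ, H.Normal → H ≠ ⊥ → commutator Γ ≤ H) ∧
      (∀ H : Subgroup (commutator Γ), H.Normal → H ≠ ⊥ →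
        commutator Γ ≤ H.map (commutator Γ).subtype)) ∧
    IsSimpleGroup (commutator Γ) := by
  have hinj : Function.Injective (Subgroup.map Γ.subtype) :=
    Subgroup.map_injective Γ.subtype_injective
  have hinj' : Function.Injective (Subgroup.map (commutator Γ).subtype) :=
    Subgroup.map_injective (commutator Γ).subtype_injective
  have key : ∀ K : Subgroup Γ, (∀ d ∈ commutator Γ, ∀ k ∈ K, d * k * d⁻¹ ∈ K) → K ≠ ⊥ →
      commutator Γ ≤ K := by
    intro K hK hKne
    rw [← Subgroup.map_le_map_iff_of_injective Γ.subtype_injective, map_subtype_commutator]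
    refine h _ ?_ ?_ fun hbot => hKne (hinj (hbot.trans (Subgroup.map_bot _).symm))
    · rintro _ ⟨k, -, rfl⟩
      exact k.2
    · rw [← map_subtype_commutator]
      rintro _ ⟨d, hd, rfl⟩ _ ⟨k, hk, rfl⟩
      exact ⟨d * k * d⁻¹, hK d hd k hk, by simp⟩
  have key' : ∀ H : Subgroup (commutator Γ), H.Normal → H ≠ ⊥ →
      commutator Γ ≤ H.map (commutator Γ).subtype := by
    intro H hH hHne
    refine key _ ?_ fun hbot => hHne (hinj' (hbot.trans (Subgroup.map_bot _).symm))
    rintro d hd _ ⟨k, hk, rfl⟩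
    exact ⟨⟨d, hd⟩ * k * ⟨d, hd⟩⁻¹, hH.conj_mem k hk _, by simp⟩
  refine ⟨⟨fun H hH hHne => key H (fun d _ k hk => hH.conj_mem k hk d) hHne, key'⟩, ?_⟩
  have hnt : Nontrivial (commutator Γ) := by
    rw [Subgroup.nontrivial_iff_ne_bot]
    intro hbot
    exact hne (by rw [← map_subtype_commutator, hbot, Subgroup.map_bot])
  exact { eq_bot_or_eq_top_of_normal := fun H hH => by
            refine or_iff_not_imp_left.2 fun hHne => eq_top_iff.2 fun x _ => ?_
            obtain ⟨y, hy, hyx⟩ := key' H hH hHne x.2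
            exact Subtype.ext hyx ▸ hy }

end

theorem mainTheorem1 {X : Type*} [TopologicalSpace X] (φ : X ≃ₜ X)
    (hφ : IsCantorMinimalSystem X φ) :
    ((∀ H : Subgroup (fullGroup φ), H.Normal → H ≠ ⊥ → commutator (fullGroup φ) ≤ H) ∧
      (∀ H : Subgroup (commutator (fullGroup φ)), H.Normal → H ≠ ⊥ →
        commutator (fullGroup φ) ≤ H.map (commutator (fullGroup φ)).subtype)) ∧
    ((∀ H : Subgroup (topologicalFullGroup φ), H.Normal → H ≠ ⊥ →
        commutator (topologicalFullGroup φ) ≤ H) ∧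
      (∀ H : Subgroup (commutator (topologicalFullGroup φ)), H.Normal → H ≠ ⊥ →
        commutator (topologicalFullGroup φ) ≤
          H.map (commutator (topologicalFullGroup φ)).subtype)) ∧
    IsSimpleGroup (commutator (fullGroup φ)) ∧
    IsSimpleGroup (commutator (topologicalFullGroup φ)) := by
  have hmem := self_mem_topologicalFullGroup φ
  obtain ⟨hne, hfull⟩ := hφ.commutator_le (swapClosed_fullGroup φ) hmem.1 le_rfl
  obtain ⟨hne', htop⟩ := hφ.commutator_le (swapClosed_topologicalFullGroup φ) hmem
    fun f hf => hf.1
  obtain ⟨h1, h2⟩ := commutator_le_and_isSimpleGroup hne hfull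
  obtain ⟨h3, h4⟩ := commutator_le_and_isSimpleGroup hne' htop
  exact ⟨h1, h3, h2, h4⟩
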